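/- Setting. Let $\Lambda$ be a finite connected simplicial complex with vertex set $V$, $N=|V|$, and let $X=|\Lambda|$ carry the Euclidean metric $d$ of the barycentric coordinates $(t_k)_{k\in V}$. For a maximal tree $T\subset\Lambda$ let $\Gamma\cong\pi_1(X)$ be the group generated by the oriented edges $\langle i,j\rangle$ (with $\langle i,i\rangle$ allowed) subject to $\langle i,j\rangle=1$ if $i=j$ or $\langle i,j\rangle$ is an edge of $T$, and $\langle i,j\rangle\langle j,k\rangle=\langle i,k\rangle$ if $i,j,k$ are vertices of a simplex. Let $\gamma_{ij}\in\Gamma$ be the image of $\langle i,j\rangle$ and $\mathcal F_\Lambda=\{\gamma_{ij}\}$. Fix also a partial order on $V$ that is total on each simplex. The dual cell of $i$ is $c_i=\{x\in X: t_i(x)\ge t_j(x)\text{ for all }j\}$. Fix $\nu>0$ such that the sets $V_i=\{x\in X: d(x,c_i)<\nu\}$ satisfy $V_{i_1}\cap\dots\cap V_{i_k}\ne\emptyset\Leftrightarrow c_{i_1}\cap\dots\cap c_{i_k}\neq\emptyset$ for all $i_1,\dots,i_k$, and fix a partition of unity $\{\chi_i\}$ subordinate to $\{V_i\}$. For a unital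 $C^*$-algebra $A$, an $(\mathcal F_\Lambda,\varepsilon)$-representation $\pi:\Gamma\to U(A)$ is a map with $\pi(e)=1$ and $\|\pi(\gamma\gamma')-\pi(\gamma)\pi(\gamma')\|<\varepsilon$ for $\gamma,\gamma'\in\mathcal F_\Lambda$. The coordinate bundle $\beta(\pi)=\{v_{ij}:c_i\cap c_j\to GL(A)\}$ is defined as follows. Let $\omega(a)=a(a^*a)^{-1/2}$ and $u_{ij}=\omega\big(\tfrac12(\pi(\gamma_{ij})+\pi(\gamma_{ij}^{-1})^*)\big)$. For $i<j$, a simplex $\sigma\ni i,j$ and $x\in c_i\cap c_j\cap|\sigma|$, put $s_k=t_k(x)/t_i(x)$ and $$v_{ij}(x)=\sum_{I}\ \Big(\prod_{k\in I}s_k\prod_{k\notin I}(1-s_k)\Big)\,u_{i_1i_2}u_{i_2i_3}\cdots u_{i_{m-1}i_m},$$ where $I=\{i=i_1<\dots<i_m=j\}$ runs over the subsets of $\{k\in\sigma: i\le k\le j\}$ that contain $i$ and $j$, and the products are over $k\in\sigma$ with $i\le k\le j$ (this does not depend on $\sigma$); $v_{ji}=v_{ij}^{-1}$, $v_{ii}=1$.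 A cocycle on $\{V_i\}$ is a family of continuous $\tilde v_{ij}:V_i\cap V_j\to GL(A)$ with $\tilde v_{ij}=\tilde v_{ji}^{-1}$ and $\tilde v_{ik}=\tilde v_{ij}\tilde v_{jk}$; it is $\delta$-flat if $\operatorname{dist}(\tilde v_{ij}(x),U(A))<\delta$ and $\|\tilde v_{ij}(x)-\tilde v_{ij}(y)\|<\delta$ for all $x,y\in V_i\cap V_j$; it extends $\beta(\pi)$ if $\tilde v_{ij}=v_{ij}$ on $c_i\cap c_j$. For such a cocycle let $E_\pi$ be the bundle over $X$ obtained from $\bigsqcup_i V_i\times A$ by identifying $(x,a)$ in the $j$-th piece with $(x,\tilde v_{ij}(x)a)$ in the $i$-th piece, $x\in V_i\cap V_j$; its class $[E_\pi]\in K_0(C(X)\otimes A)$ is the class of its right $C(X,A)$-module of continuous sections. Let $$e=\sum_{i,j}e_{ij}\otimes\chi_i^{1/2}\chi_j^{1/2}\otimes\gamma_{ij}\in M_N(\mathbb C)\otimes C(X)\otimes\mathbb C[\Gamma]$$ be the projection of the Mishchenko line bundle, let $x_\pi=(\mathrm{id}\otimes\pi)(e)\in M_N(C(X)\otimes A)$,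 with $\pi$ extended linearly to $\mathbb C[\Gamma]$, and let $\ell_\pi=[\chi(x_\pi)]\in K_0(C(X)\otimes A)$, where $\chi(x)=\frac1{2\pi i}\int_{|z-1|=1/4}(z-x)^{-1}\,dz$. Proposition. There are $\varepsilon_0>0$ and $r>0$, depending only on $\Lambda$, such that for every unital $C^*$-algebra $A$, every $0<\varepsilon<\varepsilon_0$ and every $(\mathcal F_\Lambda,\varepsilon)$-representation $\pi:\Gamma\to U(A)$: (1) $\beta(\pi)$ extends to an $r\varepsilon$-flat cocycle on $\{V_i\}$, so that $E_\pi$ is defined; (2) $\|x_\pi^2-x_\pi\|<1/4$, the circle $|z-1|=1/4$ does not meet the spectrum of $x_\pi$, and $\chi(x_\pi)$ is idempotent, so that $\ell_\pi$ is defined; (3) for every cocycle on $\{V_i\}$ that extends $\beta(\pi)$, the module of sections of $E_\pi$ is finitely generated and projective, and $$[E_\pi]=\ell_\pi\in K_0(C(X)\otimes A).$$ -/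

import Mathlib

open scoped Topology

universe u v w

/-! ## Simplicial complexes, edge-path groups -/

section EdgePath

variable {V : Type v} [DecidableEq V]

/-- The `1`-skeleton of a simplicial complex. -/
def oneSkeleton (K : AbstractSimplicialComplex V) : SimpleGraph V where
  Adj i j := i ≠ j ∧ ({i, j} : Finset V) ∈ K
  symm := ⟨fun i j h => ⟨h.1.symm, by rw [Finset.pair_comm]; exact h.2⟩⟩
  loopless := ⟨fun _ h => h.1 rfl⟩

/-- The oriented edges `⟨i, j⟩` of `K`, including the degenerate edges `⟨i, i⟩ = ⟨i⟩`. -/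
abbrev OrientedEdge (K : AbstractSimplicialComplex V) : Type v :=
  {e : V × V // ({e.1, e.2} : Finset V) ∈ K}

/-- The relators `⟨i, j⟩` for `⟨i, j⟩` an edge (or a vertex) of the tree `T`, and
`⟨i, j⟩ ⟨j, k⟩ ⟨i, k⟩⁻¹` for `i, j, k` (not necessarily distinct) vertices of a simplex. -/
def edgeRelators (K : AbstractSimplicialComplex V) (T : SimpleGraph V) :
    Set (FreeGroup (OrientedEdge K)) :=
  {r | ∃ e : OrientedEdge K, (T.Adj e.1.1 e.1.2 ∨ e.1.1 = e.1.2) ∧ r = FreeGroup.of e} ∪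
  {r | ∃ (i j k : V) (_ : ({i, j, k} : Finset V) ∈ K) (hij : ({i, j} : Finset V) ∈ K)
      (hjk : ({j, k} : Finset V) ∈ K) (hik : ({i, k} : Finset V) ∈ K),
      r = FreeGroup.of ⟨(i, j), hij⟩ * FreeGroup.of ⟨(j, k), hjk⟩ *
        (FreeGroup.of ⟨(i, k), hik⟩)⁻¹}

/-- The fundamental group `Γ` of `|K|`, in its standard presentation attached to a maximal
tree `T` (the edge-path group). -/
abbrev EdgePathGroup (K : AbstractSimplicialComplex V) (T : SimpleGraph V) : Type v :=
  PresentedGroup (edgeRelators K T)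

open scoped Classical in
/-- The element `γ_ij` of `Γ` (with the irrelevant value `1` if `⟨i, j⟩` is not an edge). -/
noncomputable def edgeElt (K : AbstractSimplicialComplex V) (T : SimpleGraph V) (i j : V) :
    EdgePathGroup K T :=
  if h : ({i, j} : Finset V) ∈ K then PresentedGroup.of ⟨(i, j), h⟩ else 1

/-- The generating set `F_Λ` of `Γ`: the image of the set of edges. -/
def edgeGenerators (K : AbstractSimplicialComplex V) (T : SimpleGraph V) :
    Set (EdgePathGroup K T) :=
  Set.range fun e : OrientedEdge K => PresentedGroup.of e

end EdgePath

/-! ## Quasi-representations -/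

section QuasiRep

variable {G : Type v} [Group G] {A : Type u} [CStarAlgebra A]

/-- `(F, δ)`-representations `π : G → GL(A)`. -/
structure IsQuasiRep (F : Set G) (δ : ℝ) (π : G → Aˣ) : Prop where
  near_unitary : ∀ g ∈ F, Metric.infDist (π g : A) (unitary A : Set A) < δ
  near_mul : ∀ g ∈ F, ∀ h ∈ F, ‖(π (g * h) : A) - (π g : A) * (π h : A)‖ < δ
  map_one : π 1 = 1

/-- `ω(a) = a (a* a)^{-1/2}`, for invertible `a`. -/
noncomputable def polarUnitary (a : A) : A :=
  a * cfc (fun t : ℝ => (√t)⁻¹) (star a * a)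

/-- The perturbation of `π` to a map that is unitary and symmetric on generators:
`ω` applied to `(π(g) + π(g⁻¹)*) / 2`. -/
noncomputable def perturbQuasiRep (π : G → Aˣ) (g : G) : A :=
  polarUnitary ((2 : ℂ)⁻¹ • ((π g : A) + star (π g⁻¹ : A)))

end QuasiRep

/-! ## Geometric realization, dual cells -/

section Realization

variable {V : Type v} [Fintype V]

/-- The geometric realization of `K`, in barycentric coordinates: functions `t ≥ 0` on the
vertices with sum `1` whose support is a simplex of `K`.  It carries the Euclidean metric of
barycentric coordinates. -/
def realization (K : AbstractSimplicialComplex V) : Set (EuclideanSpace ℝ V) :=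
  {t | (∀ i, 0 ≤ t i) ∧ ∑ i, t i = 1 ∧ Finset.univ.filter (fun i => t i ≠ 0) ∈ K}

theorem isCompact_realization (K : AbstractSimplicialComplex V) :
    IsCompact (realization K) := by
  have hclosed : IsClosed (realization K) := by
    have : realization K = ⋃ s ∈ {s : Finset V | s ∈ K},
        {t : EuclideanSpace ℝ V | (∀ i, 0 ≤ t i) ∧ ∑ i, t i = 1 ∧ ∀ i, i ∉ s → t i = 0} := by
      ext t
      simp only [realization, Set.mem_ofPred_eq, Set.mem_iUnion, exists_prop]
      constructor
      · rintro ⟨h0, h1, h2⟩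
        exact ⟨_, h2, h0, h1, fun i hi => by simpa using hi⟩
      · rintro ⟨s, hs, h0, h1, h2⟩
        refine ⟨h0, h1, (K.isRelLowerSet_faces hs).2 ?_ ?_⟩
        · intro i hi
          by_contra hc
          simp only [Finset.mem_filter] at hi
          exact hi.2 (h2 i hc)
        · by_contra hne
          rw [Finset.not_nonempty_iff_eq_empty, Finset.filter_eq_empty_iff] at hne
          have : ∑ i, t i = 0 := Finset.sum_eq_zero fun i hi => by simpa using hne hi
          rw [this] at h1
          exact zero_ne_one h1
    rw [this]
    refine Set.Finite.isClosed_biUnion (Set.toFinite _) fun s _ => ?_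
    refine IsClosed.inter ?_ (IsClosed.inter ?_ ?_)
    · have : {t : EuclideanSpace ℝ V | ∀ i, 0 ≤ t i} = ⋂ i, {t | 0 ≤ t i} := by
        ext; simp
      change IsClosed {t : EuclideanSpace ℝ V | ∀ i, 0 ≤ t i}
      rw [this]
      exact isClosed_iInter fun i => isClosed_le continuous_const (by fun_prop)
    · exact isClosed_eq (f := fun t : EuclideanSpace ℝ V => ∑ i, t i) (by fun_prop)
        continuous_const
    · have : {t : EuclideanSpace ℝ V | ∀ i, i ∉ s → t i = 0} =
          ⋂ i, ⋂ (_ : i ∉ s), {t | t i = 0} := by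
        ext; simp
      change IsClosed {t : EuclideanSpace ℝ V | ∀ i, i ∉ s → t i = 0}
      rw [this]
      exact isClosed_iInter fun i => isClosed_iInter fun _ =>
        isClosed_eq (by fun_prop) continuous_const
  refine Metric.isCompact_of_isClosed_isBounded hclosed ?_
  refine (Metric.isBounded_closedBall (x := (0 : EuclideanSpace ℝ V))
    (r := √(∑ _i : V, (1 : ℝ)))).subset ?_
  rintro t ⟨h0, h1, -⟩
  rw [mem_closedBall_zero_iff, EuclideanSpace.norm_eq]
  refine Real.sqrt_le_sqrt (Finset.sum_le_sum fun i _ => ?_)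
  have hi : t i ≤ 1 := h1 ▸ Finset.single_le_sum (fun j _ => h0 j) (Finset.mem_univ i)
  rw [Real.norm_of_nonneg (h0 i)]
  nlinarith [h0 i]

/-- The polyhedron `X = |K|`. -/
abbrev Polyhedron (K : AbstractSimplicialComplex V) : Type v := ↥(realization K)

instance (K : AbstractSimplicialComplex V) : CompactSpace (Polyhedron K) :=
  isCompact_iff_compactSpace.mp (isCompact_realization K)

variable {K : AbstractSimplicialComplex V}

/-- The vertices of the smallest simplex that contains `x`. -/
noncomputable def carrier (x : Polyhedron K) : Finset V :=
  Finset.univ.filter fun i => x.1 i ≠ 0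

variable (K) in
/-- The dual cell `c_i`, the union over the simplices `σ ∋ i` of the dual cell blocks
`{x ∈ |σ| : t_i ≥ t_j for all j ∈ σ}`. (A point whose largest barycentric coordinate
is `t_i` has `t_i > 0`, so its carrier contains `i`.) -/
def dualCell (i : V) : Set (Polyhedron K) := {x | ∀ j, x.1 j ≤ x.1 i}

variable (K) in
/-- The open `ν`-neighbourhood `V_i` of the dual cell `c_i`. -/
def dualNhd (ν : ℝ) (i : V) : Set (Polyhedron K) :=
  {x | Metric.infDist x (dualCell K i) < ν}

variable (K) in
/-- `ν` is so small that the sets `V_i` intersect exactly as the dual cells `c_i` do. -/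
def SmallRadius (ν : ℝ) : Prop :=
  0 < ν ∧ ∀ s : Finset V,
    (⋂ i ∈ s, dualNhd K ν i).Nonempty ↔ (⋂ i ∈ s, dualCell K i).Nonempty

theorem isOpen_dualNhd (ν : ℝ) (i : V) : IsOpen (dualNhd K ν i) :=
  isOpen_lt (Metric.continuous_infDist_pt _) continuous_const

theorem exists_mem_dualNhd {ν : ℝ} (hν : 0 < ν) (x : Polyhedron K) :
    ∃ i, x ∈ dualNhd K ν i := by
  have hne : (Finset.univ : Finset V).Nonempty := by
    by_contra h
    rw [Finset.not_nonempty_iff_eq_empty] at h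
    have := x.2.2.1
    rw [h] at this
    simp at this
  obtain ⟨i, -, hi⟩ := Finset.exists_max_image Finset.univ (fun i => x.1 i) hne
  refine ⟨i, ?_⟩
  have hx : x ∈ dualCell K i := fun j => hi j (Finset.mem_univ j)
  change Metric.infDist x _ < ν
  rwa [Metric.infDist_zero_of_mem hx]

end Realization

/-! ## Cocycles, and the coordinate bundle of a quasi-representation -/

section Cocycle

variable {V : Type v} {X : Type v} [TopologicalSpace X]

/-- A Čech `1`-cocycle `v_ij : U_i ∩ U_j → GL(A)`; the values of `v i j` outside
`U i ∩ U j` play no role. -/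
structure GLCocycle (U : V → Set X) (A : Type u) [CStarAlgebra A] where
  toFun : V → V → X → Aˣ
  continuousOn : ∀ i j, ContinuousOn (toFun i j) (U i ∩ U j)
  inv : ∀ i j, ∀ x ∈ U i ∩ U j, toFun i j x = (toFun j i x)⁻¹
  mul : ∀ i j k, ∀ x ∈ U i ∩ U j ∩ U k, toFun i k x = toFun i j x * toFun j k x

variable {A : Type u} [CStarAlgebra A] {U : V → Set X}

/-- `ε`-flat cocycles. -/
def GLCocycle.IsFlat (v : GLCocycle U A) (ε : ℝ) : Prop :=
  (∀ i j, ∀ x ∈ U i ∩ U j, Metric.infDist (v.toFun i j x : A) (unitary A : Set A) < ε) ∧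
  ∀ i j, ∀ x ∈ U i ∩ U j, ∀ y ∈ U i ∩ U j,
    ‖(v.toFun i j x : A) - (v.toFun i j y : A)‖ < ε

end Cocycle

section Beta

variable {V : Type v} [PartialOrder V] {A : Type u} [CStarAlgebra A]

open scoped Classical in
/-- `u_I = u_{i₁ i₂} u_{i₂ i₃} ⋯ u_{i_{m-1} i_m}`, where `I = {i₁ < i₂ < ⋯ < i_m}`;
it is used for totally ordered sets `I` of vertices only. -/
noncomputable def ascendingProd (u : V → V → A) (I : Finset V) : A :=
  if h : ∃ l : List V, l.Pairwise (· < ·) ∧ l.toFinset = I then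
    (List.zipWith u h.choose h.choose.tail).prod
  else 0

open scoped Classical in
/-- For vertices `i < j` of the simplex `σ` and modified barycentric coordinates
`s` on `c_ij^σ`: the sum of `λ_I(s) u_I` over the sets `I` with
`{i, j} ⊆ I ⊆ {k ∈ σ : i ≤ k ≤ j}`, where
`λ_I(s) = ∏_{k ∈ I} s_k ∏_{k ∉ I} (1 - s_k)`, the products being over `k ∈ σ`, `i ≤ k ≤ j`. -/
noncomputable def blockFun (u : V → V → A) (σ : Finset V) (i j : V) (s : V → ℝ) : A :=
  ∑ I ∈ (σ.filter fun k => i ≤ k ∧ k ≤ j).powerset.filter fun I => i ∈ I ∧ j ∈ I,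
    ((∏ k ∈ σ.filter fun k => i ≤ k ∧ k ≤ j, if k ∈ I then s k else 1 - s k : ℝ) : ℂ) •
      ascendingProd u I

theorem blockFun_eq_of_subset (u : V → V → A) {τ σ : Finset V} (hτσ : τ ⊆ σ) (i j : V)
    (s : V → ℝ) (hs : ∀ k ∈ σ, k ∉ τ → s k = 0) :
    blockFun u σ i j s = blockFun u τ i j s := by
  classical
  unfold blockFun
  symm
  refine Finset.sum_subset_zero_on_sdiff ?_ ?_ ?_
  · intro I hI
    simp only [Finset.mem_filter, Finset.mem_powerset] at hI ⊢
    exact ⟨hI.1.trans (Finset.filter_subset_filter _ hτσ), hI.2⟩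
  · intro I hI
    simp only [Finset.mem_sdiff, Finset.mem_filter, Finset.mem_powerset, not_and] at hI
    have : ∃ k ∈ I, k ∉ τ := by
      by_contra hc
      push Not at hc
      refine hI.2 (fun k hk => ?_) hI.1.2.1 hI.1.2.2
      have := hI.1.1 hk
      rw [Finset.mem_filter] at this ⊢
      exact ⟨hc k hk, this.2⟩
    obtain ⟨k, hkI, hkτ⟩ := this
    have hkσ := hI.1.1 hkI
    rw [Finset.prod_eq_zero hkσ, Complex.ofReal_zero, zero_smul]
    rw [if_pos hkI]
    exact hs k (Finset.mem_filter.mp hkσ).1 hkτ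
  · intro I hI
    simp only [Finset.mem_filter, Finset.mem_powerset] at hI
    congr 2
    refine Finset.prod_subset (Finset.filter_subset_filter _ hτσ) ?_
    intro k hk hk'
    rw [Finset.mem_filter] at hk hk'
    have hkτ : k ∉ τ := fun h => hk' ⟨h, hk.2⟩
    rw [if_neg, hs k hk.1 hkτ, sub_zero]
    intro hkI
    exact hkτ (Finset.mem_filter.mp (hI.1 hkI)).1

/-- The functions on the dual cell blocks agree: any simplex `σ` that contains `x` gives the
same value as the smallest one. -/
theorem blockFun_eq_carrier [Fintype V] {K : AbstractSimplicialComplex V}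
    (u : V → V → A) (x : Polyhedron K) {σ : Finset V} (hσ : carrier x ⊆ σ) (i j l : V) :
    blockFun u σ i j (fun k => x.1 k / x.1 l) =
      blockFun u (carrier x) i j (fun k => x.1 k / x.1 l) := by
  refine blockFun_eq_of_subset u hσ i j _ fun k _ hk => ?_
  have : x.1 k = 0 := by
    by_contra h
    exact hk (by simpa [carrier] using h)
  simp [this]

variable [Fintype V] [DecidableEq V] {K : AbstractSimplicialComplex V}

open scoped Classical in
/-- The coordinate bundle `β(π) = {v_ij : c_ij → GL(A)}`.  For `i < j` and `x ∈ c_ij`, it is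
given by `blockFun` on any simplex `σ` that contains `x`, `i` and `j`
(we use the smallest one, see `blockFun_eq_carrier`) with `u_ij = π̆(γ_ij)`, in
the modified barycentric coordinates `s_k = t_k / t_i`; for `i > j`, `v_ij = v_ji⁻¹`. -/
noncomputable def betaBundle {T : SimpleGraph V} (π : EdgePathGroup K T → Aˣ) (i j : V)
    (x : Polyhedron K) : A :=
  let u : V → V → A := fun k l => perturbQuasiRep π (edgeElt K T k l)
  if i < j then blockFun u (carrier x) i j (fun k => x.1 k / x.1 i)
  else if j < i then Ring.inverse (blockFun u (carrier x) j i (fun k => x.1 k / x.1 j))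
  else 1

/-- A cocycle on the open cover `{V_i}` extends a family of functions on the `c_i ∩ c_j`. -/
def GLCocycle.Extends {ν : ℝ} (v : GLCocycle (dualNhd K ν) A) (b : V → V → Polyhedron K → A) :
    Prop :=
  ∀ i j, ∀ x ∈ dualCell K i ∩ dualCell K j, (v.toFun i j x : A) = b i j x

end Beta

/-! ## The bundle of a cocycle and its module of sections -/

section BundleOfCocycle

variable {V X : Type v} [TopologicalSpace X] {A : Type u} [CStarAlgebra A] {U : V → Set X}

theorem GLCocycle.self_eq_one (v : GLCocycle U A) {i : V} {x : X} (hx : x ∈ U i) :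
    v.toFun i i x = 1 := by
  have h := v.mul i i i x ⟨⟨hx, hx⟩, hx⟩
  simpa using h

/-- The locally trivial bundle over `X` with fibre `A` glued from the `U_i × A`, where
`(x, a)` in the `j`-th piece is identified with `(x, v_ij(x) a)` in the `i`-th piece. -/
noncomputable def cocycleBundle (hU : ∀ i, IsOpen (U i)) (hcov : ∀ x, ∃ i, x ∈ U i)
    (v : GLCocycle U A) : FiberBundleCore V X A where
  baseSet := U
  isOpen_baseSet := hU
  indexAt x := (hcov x).choose
  mem_baseSet_at x := (hcov x).choose_spec
  coordChange j i x a := (v.toFun i j x : A) * a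
  coordChange_self i x hx a := by simp [v.self_eq_one hx]
  continuousOn_coordChange j i := by
    have h1 : ContinuousOn (fun x => (v.toFun i j x : A)) (U i ∩ U j) :=
      Units.continuous_val.comp_continuousOn (v.continuousOn i j)
    refine ContinuousOn.mul (h1.comp continuous_fst.continuousOn ?_) continuous_snd.continuousOn
    rintro ⟨x, a⟩ ⟨⟨hj, hi⟩, -⟩
    exact ⟨hi, hj⟩
  coordChange_comp i j k x hx a := by
    rw [← mul_assoc, ← Units.val_mul, v.mul k j i x ⟨⟨hx.2, hx.1.2⟩, hx.1.1⟩]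

/-- A function `s`, with `s x` in the fibre over `x`, is a continuous section. -/
def IsContSection (Z : FiberBundleCore V X A) (s : ∀ x, Z.Fiber x) : Prop :=
  Continuous fun x => (⟨x, s x⟩ : Bundle.TotalSpace A Z.Fiber)

theorem isContSection_iff (hU : ∀ i, IsOpen (U i)) (hcov : ∀ x, ∃ i, x ∈ U i)
    (v : GLCocycle U A) (s : X → A) :
    IsContSection (cocycleBundle hU hcov v) s ↔
      ∀ x₀, ContinuousAt (fun x => (v.toFun (hcov x₀).choose (hcov x).choose x : A) * s x) x₀ := by
  unfold IsContSection
  rw [continuous_iff_continuousAt]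
  refine forall_congr' fun x₀ => ?_
  rw [FiberBundle.continuousAt_totalSpace]
  exact and_iff_right continuousAt_id

/-- The additive group of continuous sections of the bundle of a cocycle (each fibre is `A`, in
the coordinates of the chosen piece at `x`). -/
noncomputable def bundleSections (hU : ∀ i, IsOpen (U i)) (hcov : ∀ x, ∃ i, x ∈ U i)
    (v : GLCocycle U A) : AddSubgroup (X → A) where
  carrier := {s | IsContSection (cocycleBundle hU hcov v) s}
  add_mem' {s t} hs ht := by
    have hs' := (isContSection_iff hU hcov v s).mp hs
    have ht' := (isContSection_iff hU hcov v t).mp ht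
    refine (isContSection_iff hU hcov v _).mpr fun x₀ => ?_
    simp only [Pi.add_apply, mul_add]
    exact (hs' x₀).add (ht' x₀)
  zero_mem' := (isContSection_iff hU hcov v _).mpr fun x₀ => by
    simpa using continuousAt_const
  neg_mem' {s} hs := by
    have hs' := (isContSection_iff hU hcov v s).mp hs
    refine (isContSection_iff hU hcov v _).mpr fun x₀ => ?_
    simp only [Pi.neg_apply, mul_neg]
    exact (hs' x₀).neg

/-- The right `C(X, A)`-module structure on sections: `(s f)(x) = s(x) f(x)`. -/
noncomputable instance (hU : ∀ i, IsOpen (U i)) (hcov : ∀ x, ∃ i, x ∈ U i)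
    (v : GLCocycle U A) : Module C(X, A)ᵐᵒᵖ (bundleSections hU hcov v) where
  smul f s := ⟨fun x => s.1 x * f.unop x, by
    have hs := (isContSection_iff hU hcov v _).mp s.2
    refine (isContSection_iff hU hcov v _).mpr fun x₀ => ?_
    simp only [← mul_assoc]
    exact (hs x₀).mul f.unop.continuous.continuousAt⟩
  one_smul s := Subtype.ext (funext fun x => mul_one (s.1 x))
  mul_smul f g s := Subtype.ext (funext fun x => (mul_assoc (s.1 x) (g.unop x) (f.unop x)).symm)
  smul_zero f := Subtype.ext (funext fun x => zero_mul (f.unop x))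
  smul_add f s t := Subtype.ext (funext fun x => add_mul (s.1 x) (t.1 x) (f.unop x))
  add_smul f g s := Subtype.ext (funext fun x => mul_add (s.1 x) (f.unop x) (g.unop x))
  zero_smul s := Subtype.ext (funext fun x => mul_zero (s.1 x))

end BundleOfCocycle

/-! ## The group `K₀` of a ring -/

section KZero

/-- Finitely generated projective right `R`-modules. -/
structure FGProj (R : Type w) [Ring R] where
  carrier : Type w
  [addCommGroup : AddCommGroup carrier]
  [module : Module Rᵐᵒᵖ carrier]
  [finite : Module.Finite Rᵐᵒᵖ carrier]
  [projective : Module.Projective Rᵐᵒᵖ carrier]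

attribute [instance] FGProj.addCommGroup FGProj.module FGProj.finite FGProj.projective

variable (R : Type w) [Ring R]

/-- Isomorphism of finitely generated projective right modules. -/
instance FGProj.setoid : Setoid (FGProj R) where
  r P Q := Nonempty (P.carrier ≃ₗ[Rᵐᵒᵖ] Q.carrier)
  iseqv := ⟨fun _ => ⟨LinearEquiv.refl _ _⟩, fun ⟨e⟩ => ⟨e.symm⟩,
    fun ⟨e⟩ ⟨f⟩ => ⟨e.trans f⟩⟩

/-- The set of isomorphism classes of finitely generated projective right `R`-modules. -/
def FGProjClass : Type (w + 1) := Quotient (FGProj.setoid R)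

instance : Zero (FGProjClass R) := ⟨Quotient.mk _ ⟨PUnit⟩⟩

/-- The sum of isomorphism classes is induced by the direct sum of modules. -/
instance : Add (FGProjClass R) :=
  ⟨Quotient.map₂ (fun P Q => ⟨P.carrier × Q.carrier⟩)
    fun _ _ ⟨e⟩ _ _ ⟨f⟩ => ⟨e.prodCongr f⟩⟩

instance : AddCommMonoid (FGProjClass R) where
  add_assoc := by
    rintro ⟨P⟩ ⟨Q⟩ ⟨S⟩
    exact Quotient.sound ⟨LinearEquiv.prodAssoc _ _ _ _⟩
  zero_add := by
    rintro ⟨P⟩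
    exact Quotient.sound ⟨LinearEquiv.uniqueProd⟩
  add_zero := by
    rintro ⟨P⟩
    exact Quotient.sound ⟨LinearEquiv.prodUnique⟩
  add_comm := by
    rintro ⟨P⟩ ⟨Q⟩
    exact Quotient.sound ⟨LinearEquiv.prodComm _ _ _⟩
  nsmul := nsmulRec

/-- `K₀(R)`: the Grothendieck group of the monoid of isomorphism classes of finitely generated
projective right modules. -/
abbrev KZero : Type (w + 1) := Algebra.GrothendieckAddGroup (FGProjClass R)

/-- The class in `K₀(R)` of a finitely generated projective right `R`-module. -/
noncomputable def KZero.ofModule (M : Type w) [AddCommGroup M] [Module Rᵐᵒᵖ M]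
    [Module.Finite Rᵐᵒᵖ M] [Module.Projective Rᵐᵒᵖ M] : KZero R :=
  Algebra.GrothendieckAddGroup.of (Quotient.mk (FGProj.setoid R) ⟨M⟩ : FGProjClass R)

variable {R} {n : Type v} [Fintype n]

/-- The right module `p Rⁿ = {w ∈ Rⁿ : p w = w}` of an idempotent matrix `p`. -/
def idempotentModule (p : Matrix n n R) : Submodule Rᵐᵒᵖ (n → R) where
  carrier := {w | p.mulVec w = w}
  add_mem' {a b} ha hb := by
    change p.mulVec (a + b) = a + b
    rw [Matrix.mulVec_add, ha, hb]
  zero_mem' := Matrix.mulVec_zero p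
  smul_mem' c a ha := by
    change p.mulVec (c • a) = c • a
    rw [Matrix.mulVec_smul, ha]

/-- The projection of `Rⁿ` onto `p Rⁿ`. -/
def idempotentProj (p : Matrix n n R) (hp : IsIdempotentElem p) :
    (n → R) →ₗ[Rᵐᵒᵖ] idempotentModule p where
  toFun w := ⟨p.mulVec w, by
    change p.mulVec (p.mulVec w) = p.mulVec w
    rw [Matrix.mulVec_mulVec, hp.eq]⟩
  map_add' a b := Subtype.ext (Matrix.mulVec_add p a b)
  map_smul' c a := Subtype.ext (Matrix.mulVec_smul p c a)

theorem idempotentProj_comp (p : Matrix n n R) (hp : IsIdempotentElem p) :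
    (idempotentProj p hp).comp (idempotentModule p).subtype = LinearMap.id :=
  LinearMap.ext fun w => Subtype.ext w.2

/-- `R` is a free right module of rank one over itself. -/
def opRightEquiv : Rᵐᵒᵖ ≃ₗ[Rᵐᵒᵖ] R where
  toFun r := r.unop
  invFun r := MulOpposite.op r
  map_add' _ _ := rfl
  map_smul' _ _ := rfl

theorem idempotentModule_finite (p : Matrix n n R) (hp : IsIdempotentElem p) :
    Module.Finite Rᵐᵒᵖ (idempotentModule p) :=
  haveI : Module.Finite Rᵐᵒᵖ R := Module.Finite.equiv (opRightEquiv (R := R))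
  Module.Finite.of_surjective (idempotentProj p hp) fun w =>
    ⟨w.1, LinearMap.congr_fun (idempotentProj_comp p hp) w⟩

theorem idempotentModule_projective (p : Matrix n n R) (hp : IsIdempotentElem p) :
    Module.Projective Rᵐᵒᵖ (idempotentModule p) :=
  haveI : Module.Projective Rᵐᵒᵖ R := Module.Projective.of_equiv (opRightEquiv (R := R))
  haveI : Module.Projective Rᵐᵒᵖ (n → R) :=
    Module.Projective.of_equiv (LinearEquiv.piCongrRight fun _ : n => opRightEquiv (R := R))
  Module.Projective.of_split _ _ (idempotentProj_comp p hp)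

end KZero

section KZeroIdempotent

/-- The class in `K₀(R)` of an idempotent `n × n` matrix over `R`. -/
noncomputable def KZero.ofIdempotent {n : Type v} [Fintype n] {R : Type (max v u)} [Ring R]
    (p : Matrix n n R) (hp : IsIdempotentElem p) : KZero R :=
  haveI := idempotentModule_finite p hp
  haveI := idempotentModule_projective p hp
  KZero.ofModule R (idempotentModule p)

end KZeroIdempotent

/-! ## The Mishchenko projection and its push-forward -/

section PushForward

/-- The C*-norm of a matrix over the C*-algebra `B`. -/
noncomputable def matrixNorm {n : Type v} [Fintype n] {B : Type w} [CStarAlgebra B]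
    (x : Matrix n n B) : ℝ :=
  letI := CStarAlgebra.spectralOrder B
  letI : StarOrderedRing B := CStarAlgebra.spectralOrderedRing B
  ‖CStarMatrix.ofMatrix x‖

/-- `χ(x) = (2πi)⁻¹ ∫_C (z - x)⁻¹ dz`, `C = {z : |z - 1| = 1/4}`, computed in the C*-algebra
of `n × n` matrices over `B`. -/
noncomputable def chiCalculus {n : Type v} [Fintype n] [DecidableEq n] {B : Type w}
    [CStarAlgebra B] (x : Matrix n n B) : Matrix n n B :=
  letI := CStarAlgebra.spectralOrder B
  letI : StarOrderedRing B := CStarAlgebra.spectralOrderedRing B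
  CStarMatrix.ofMatrix.symm
    ((2 * Real.pi * Complex.I : ℂ)⁻¹ •
      ∮ z in C(1, 1 / 4), resolvent (CStarMatrix.ofMatrix x) z)

variable {V : Type v} [Fintype V] [DecidableEq V] {K : AbstractSimplicialComplex V}

/-- The Mishchenko projection `e = ∑ e_ij ⊗ χ_i^{1/2} χ_j^{1/2} ⊗ γ_ij`, a matrix with entries
in `C(X) ⊗ ℂ[Γ]`, that is, in the group algebra of `Γ` with coefficients in `C(X)`. -/
noncomputable def mishchenkoProj (T : SimpleGraph V)
    (χ : PartitionOfUnity V (Polyhedron K)) :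
    Matrix V V (MonoidAlgebra C(Polyhedron K, ℂ) (EdgePathGroup K T)) :=
  fun i j => MonoidAlgebra.single (edgeElt K T i j)
    ⟨fun x => ((√(χ i x) * √(χ j x) : ℝ) : ℂ), by fun_prop⟩

/-- `id ⊗ π : C(X) ⊗ ℂ[G] → C(X) ⊗ A = C(X, A)`, with `π` extended linearly to `ℂ[G]`. -/
noncomputable def idTensor {X : Type v} [TopologicalSpace X] {G : Type v} {A : Type u}
    [CStarAlgebra A] (π : G → A) (f : MonoidAlgebra C(X, ℂ) G) : C(X, A) :=
  f.coeff.sum fun g a => a • ContinuousMap.const X (π g)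

/-- The matrix `(id ⊗ π)(e)` over `C(X, A)`, to which `χ` is applied to obtain `ℓ_π`. -/
noncomputable def pushMishchenko (T : SimpleGraph V) (χ : PartitionOfUnity V (Polyhedron K))
    {A : Type u} [CStarAlgebra A] (π : EdgePathGroup K T → A) :
    Matrix V V C(Polyhedron K, A) :=
  (mishchenkoProj T χ).map (idTensor π)

end PushForward

/-!
Write `P i j = π (γ_ij)`, a family of unitaries that satisfies the cocycle identity up to `ε` on
every simplex, and `s_k = t_k / max t`, so that `c_l = {s_l = 1}`.

*The cocycle identity on the dual cells.* The function `v_ij` is a weighted mean of products along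
ascending paths from `i` to `j`. Where `s_j = 1`, only paths through `j` have a non-zero weight,
and these split at `j`; hence `v_ik = v_ij v_jk` on `c_i ∩ c_j ∩ c_k` (`blockFun_mul`). All factors
are close to values of `P`, so `v_ij` is close to `P i j` (`IsAlmostCocycle.blockFun_near`).

*The extension.* For a cocycle on the `V_i` it suffices to give a frame of the bundle over each
`V_i`: invertible functions `h_i^l` on `V_i ∩ c_l` with `h_i^k = h_i^l v_lk` on `V_i ∩ c_l ∩ c_k`
for `l < k`, and `h_i^i = 1`; then `h_i^l (h_j^l)⁻¹` does not depend on `l` and extends `v_ij`.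
Where `s_k < 1` for all `k < m`, only cells `c_l` with `m ≤ l` meet, and there the functions
`v_ml`, which make sense for `s_m < 1`, satisfy `v_mk = v_ml v_lk`. So `v_mi⁻¹ v_ml` is a frame as
required, where it is defined. With bump functions `b_m` around `c_m`, the weights
`b_m ∏_{k < m} (1 - b_k)` add up to `1` and are supported where the `m`-th of these local
frames behaves well; `frame` is their weighted mean, with `v_mi` deformed to a constant away from
`c_i`. As everything is close to values of `P`, the frame is invertible and the cocycle is flat
(`IsExtensionDatum.cocycle_near`, `IsExtensionDatum.isFlat_cocycle`).

*The K-theory class.* Two cocycles that agree on the dual cells are cohomologous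
(`nonempty_bundleSectionsEquiv`), so any extension may be replaced by the flat one, `v`. Its module
of sections is the image of the idempotent matrix `q = (χ_i^{1/2} χ_j^{1/2} v_ij)`
(`bundleSectionsEquivIdempotent`). Since `v_ij` is close to `P i j`, the matrix `q` is close to
`x_π`. For an element `x` close to an idempotent `q`, the Riesz integral `χ(x)` is an idempotent
close to `χ(q) = q`, hence similar to `q` (`chiCalculus_of_near_idempotent`), and similar idempotents
have isomorphic modules.
-/

/-! ### The Riesz idempotent of an element close to an idempotent -/

section Riesz

open Complex Metric

variable {B : Type w} [NormedRing B] [NormedAlgebra ℂ B] [CompleteSpace B]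

/-- The Riesz integral `(2πi)⁻¹ ∮ (z - x)⁻¹ dz` over the circle `|z - c| = R`. -/
noncomputable def rieszIntegral (x : B) (c : ℂ) (R : ℝ) : B :=
  (2 * Real.pi * I : ℂ)⁻¹ • ∮ z in C(c, R), resolvent x z

theorem ContinuousLinearMap.circleIntegral_comp_comm {E F : Type*} [NormedAddCommGroup E]
    [NormedSpace ℂ E] [CompleteSpace E] [NormedAddCommGroup F] [NormedSpace ℂ F] [CompleteSpace F]
    (L : E →L[ℂ] F) {f : ℂ → E} {c : ℂ} {R : ℝ} (hf : CircleIntegrable f c R) :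
    L (∮ z in C(c, R), f z) = ∮ z in C(c, R), L (f z) := by
  unfold circleIntegral
  rw [← ContinuousLinearMap.intervalIntegral_comp_comm L hf.out]
  simp

theorem continuousOn_resolvent (x : B) : ContinuousOn (resolvent x) (resolventSet ℂ x) :=
  fun _ hz => (spectrum.hasDerivAt_resolvent_const_left hz).continuousAt.continuousWithinAt

/-- The Riesz integral over a circle is idempotent as soon as a whole annulus inside the circle
lies in the resolvent set. Writing one factor over the outer circle and the other one over the
inner circle, the resolvent identity gives `P R(w) = R(w) - G(w)` for `w` on the inner circle,
where `G` is a Cauchy integral over the outer circle, hence holomorphic inside it, so that it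
does not contribute to the integral over the inner circle. -/
theorem isIdempotentElem_rieszIntegral {x : B} {c : ℂ} {r R : ℝ} (hr : 0 < r) (hrR : r < R)
    (hx : ∀ z, r ≤ ‖z - c‖ → ‖z - c‖ ≤ R → z ∈ resolventSet ℂ x) :
    IsIdempotentElem (rieszIntegral x c R) := by
  have hR : 0 < R := hr.trans hrR
  have hxR : ∀ z ∈ sphere c R, z ∈ resolventSet ℂ x := fun z hz => by
    rw [mem_sphere_iff_norm] at hz
    exact hx z (by linarith) (by linarith)
  have hxr : ∀ z ∈ sphere c r, z ∈ resolventSet ℂ x := fun z hz => by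
    rw [mem_sphere_iff_norm] at hz
    exact hx z (by linarith) (by linarith)
  have hcR : ContinuousOn (resolvent x) (sphere c R) := (continuousOn_resolvent x).mono hxR
  have hcr : ContinuousOn (resolvent x) (sphere c r) := (continuousOn_resolvent x).mono hxr
  have hiR : CircleIntegrable (resolvent x) c R := hcR.circleIntegrable hR.le
  have hir : CircleIntegrable (resolvent x) c r := hcr.circleIntegrable hr.le
  -- the two circles give the same integral
  have heq : rieszIntegral x c R = rieszIntegral x c r := by
    unfold rieszIntegral
    congr 1
    refine circleIntegral_eq_of_differentiable_on_annulus_off_countable hr hrR.le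
      Set.countable_empty ?_ ?_
    · refine (continuousOn_resolvent x).mono fun z hz => ?_
      simp only [Set.mem_sdiff, mem_closedBall, mem_ball, dist_eq_norm, not_lt] at hz
      exact hx z hz.2 hz.1
    · intro z hz
      simp only [Set.mem_sdiff, mem_closedBall, mem_ball, dist_eq_norm, not_le,
        Set.mem_empty_iff_false, not_false_eq_true, and_true] at hz
      exact (spectrum.hasDerivAt_resolvent_const_left
        (hx z hz.2.le hz.1.le)).differentiableAt
  -- the Cauchy integral of the resolvent over the outer circle
  set G : ℂ → B := fun w => (2 * Real.pi * I : ℂ)⁻¹ • ∮ z in C(c, R), (z - w)⁻¹ • resolvent x z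
    with hG
  have hGd : DifferentiableOn ℂ G (ball c R) := by
    have h := hasFPowerSeriesOn_cauchy_integral (f := resolvent x) (c := c) (R := ⟨R, hR.le⟩)
      hiR hR
    exact h.differentiableOn.mono (Metric.eball_coe (x := c) (ε := ⟨R, hR.le⟩)).ge
  have hsub : closedBall c r ⊆ ball c R := closedBall_subset_ball hrR
  have hG0 : ∮ w in C(c, r), G w = 0 := by
    refine circleIntegral_eq_zero_of_differentiable_on_off_countable hr.le Set.countable_empty
      (hGd.continuousOn.mono hsub) fun z hz => ?_
    exact (hGd z (hsub (ball_subset_closedBall hz.1))).differentiableAt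
      (isOpen_ball.mem_nhds (hsub (ball_subset_closedBall hz.1)))
  have hPR : ∀ w ∈ sphere c r, rieszIntegral x c R * resolvent x w = resolvent x w - G w := by
    intro w hw
    have hwb : w ∈ ball c R := hsub (sphere_subset_closedBall hw)
    have hne : ∀ z ∈ sphere c R, z - w ≠ 0 := fun z hz h => by
      rw [sub_eq_zero] at h
      rw [← h] at hwb
      simp only [mem_ball, mem_sphere] at hwb hz
      linarith
    have hci : ContinuousOn (fun z : ℂ => (z - w)⁻¹) (sphere c R) :=
      (continuousOn_id.sub continuousOn_const).inv₀ hne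
    have h1 : rieszIntegral x c R * resolvent x w =
        (2 * Real.pi * I : ℂ)⁻¹ • ∮ z in C(c, R), resolvent x z * resolvent x w := by
      unfold rieszIntegral
      rw [smul_mul_assoc]
      congr 1
      exact ContinuousLinearMap.circleIntegral_comp_comm
        ((ContinuousLinearMap.mul ℂ B).flip (resolvent x w)) hiR
    have h2 : (∮ z in C(c, R), resolvent x z * resolvent x w) =
        ∮ z in C(c, R), ((z - w)⁻¹ • resolvent x w - (z - w)⁻¹ • resolvent x z) := by
      refine circleIntegral.integral_congr hR.le fun z hz => ?_
      have hz' := hxR z hz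
      have hw' := hxr w hw
      have e1 : resolvent x z * resolvent x w =
          (z - w)⁻¹ • (resolvent x w - resolvent x z) := by
        rw [eq_inv_smul_iff₀ (hne z hz)]
        rw [spectrum.resolvent_eq hz', spectrum.resolvent_eq hw']
        have hzw : (z - w) • (1 : B) = (hz'.unit : B) - hw'.unit := by
          simp [sub_smul, Algebra.algebraMap_eq_smul_one]
        have : (z - w) • (((hz'.unit⁻¹ : Bˣ) : B) * ((hw'.unit⁻¹ : Bˣ) : B)) =
            ((hz'.unit⁻¹ : Bˣ) : B) * ((z - w) • (1 : B)) * ((hw'.unit⁻¹ : Bˣ) : B) := by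
          simp
        rw [this, hzw, mul_sub, sub_mul, mul_assoc _ _ ((hw'.unit⁻¹ : Bˣ) : B)]
        simp
      rw [← smul_sub]
      exact e1
    rw [h1, h2, circleIntegral.integral_sub, circleIntegral.integral_smul_const,
      circleIntegral.integral_sub_inv_of_mem_ball hwb, smul_sub, smul_smul,
      inv_mul_cancel₀ Complex.two_pi_I_ne_zero, one_smul]
    · exact (hci.smul continuousOn_const).circleIntegrable hR.le
    · exact (hci.smul hcR).circleIntegrable hR.le
  have h3 : rieszIntegral x c R * rieszIntegral x c r =
      (2 * Real.pi * I : ℂ)⁻¹ • ∮ w in C(c, r), rieszIntegral x c R * resolvent x w := by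
    conv_lhs => rw [rieszIntegral.eq_1 x c r]
    rw [mul_smul_comm]
    congr 1
    exact ContinuousLinearMap.circleIntegral_comp_comm
      (ContinuousLinearMap.mul ℂ B (rieszIntegral x c R)) hir
  change rieszIntegral x c R * rieszIntegral x c R = rieszIntegral x c R
  conv_lhs => rw [heq, ← heq]
  nth_rewrite 2 [heq]
  rw [h3, circleIntegral.integral_congr hr.le hPR, circleIntegral.integral_sub hir, hG0, sub_zero,
    heq]
  · rfl
  · exact ((hGd.continuousOn.mono hsub).mono sphere_subset_closedBall).circleIntegrable hr.le

/-- Off `0` and `1`, the resolvent of an idempotent `q` is `q / (z - 1) + (1 - q) / z`. -/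
theorem IsIdempotentElem.resolvent_mul {B : Type w} [NormedRing B] [NormedAlgebra ℂ B] {q : B}
    (hq : IsIdempotentElem q) {z : ℂ} (h0 : z ≠ 0)
    (h1 : z - 1 ≠ 0) :
    (algebraMap ℂ B z - q) * ((z - 1)⁻¹ • q + z⁻¹ • (1 - q)) = 1 ∧
      ((z - 1)⁻¹ • q + z⁻¹ • (1 - q)) * (algebraMap ℂ B z - q) = 1 := by
  have e : ((z - 1)⁻¹ * z) • q = q + (z - 1)⁻¹ • q := by
    nth_rewrite 2 [← one_smul ℂ q]
    rw [← add_smul]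
    congr 1
    field_simp
    ring
  rw [Algebra.algebraMap_eq_smul_one]
  constructor
  · simp only [sub_mul, mul_add, mul_sub, mul_smul_comm, smul_mul_assoc, one_mul, hq.eq,
      mul_one, smul_sub, smul_smul, inv_mul_cancel₀ h0, one_smul, e]
    abel
  · simp only [mul_sub, add_mul, sub_mul, mul_smul_comm, smul_mul_assoc, one_mul, hq.eq,
      mul_one, sub_self, add_zero, smul_add, smul_sub, smul_smul, mul_comm z, inv_mul_cancel₀ h0,
      one_smul, e]
    abel

/-- An element `x` close to an idempotent `q`: the annulus `1/5 ≤ |z - 1| ≤ 1/4` lies in the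
resolvent set of `x`, where the resolvents of `x` and `q` are close; hence the Riesz integral is an
idempotent close to the Riesz integral of `q`, which is `q` itself. -/
theorem rieszIntegral_of_near_idempotent {q x : B} (hq : IsIdempotentElem q) {m : ℝ}
    (hm : 0 < m) (h1 : ‖q‖ ≤ m) (h2 : ‖1 - q‖ ≤ m) (hx : 14 * m * ‖x - q‖ ≤ 1) :
    (∀ z ∈ sphere (1 : ℂ) (1 / 4), z ∈ resolventSet ℂ x) ∧
      IsIdempotentElem (rieszIntegral x 1 (1 / 4)) ∧
      ‖rieszIntegral x 1 (1 / 4) - q‖ ≤ 25 * m ^ 2 * ‖x - q‖ := by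
  have key : ∀ z : ℂ, 1 / 5 ≤ ‖z - 1‖ → ‖z - 1‖ ≤ 1 / 4 → z ∈ resolventSet ℂ x ∧
      ‖resolvent x z - ((z - 1)⁻¹ • q + z⁻¹ • (1 - q))‖ ≤ 98 * m ^ 2 * ‖x - q‖ := by
    intro z hz hz'
    have hz1 : z - 1 ≠ 0 := by
      intro h; rw [h] at hz; norm_num at hz
    have hz0n : 3 / 4 ≤ ‖z‖ := by
      have := norm_sub_norm_le (1 : ℂ) (1 - z)
      rw [sub_sub_cancel, norm_one, norm_sub_rev] at this
      linarith
    have hz0 : z ≠ 0 := by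
      intro h; rw [h] at hz0n; norm_num at hz0n
    obtain ⟨ha, hb⟩ := hq.resolvent_mul hz0 hz1
    set S := (z - 1)⁻¹ • q + z⁻¹ • (1 - q) with hS
    have hSn : ‖S‖ ≤ 7 * m := by
      have e1 : ‖(z - 1)⁻¹ • q‖ ≤ 5 * m := by
        rw [norm_smul, norm_inv]
        have : ‖z - 1‖⁻¹ ≤ 5 := by
          rw [inv_le_comm₀ (by linarith) (by norm_num)]; linarith
        gcongr
      have e2 : ‖z⁻¹ • (1 - q)‖ ≤ 2 * m := by
        rw [norm_smul, norm_inv]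
        have : ‖z‖⁻¹ ≤ 2 := by
          rw [inv_le_comm₀ (by linarith) (by norm_num)]; linarith
        gcongr
      calc ‖S‖ ≤ _ := norm_add_le _ _
        _ ≤ 7 * m := by linarith
    have hsm : ‖S‖ * ‖x - q‖ ≤ 1 / 2 := by nlinarith [norm_nonneg (x - q)]
    have hu : IsUnit (1 - S * (x - q)) := by
      refine isUnit_one_sub_of_norm_lt_one ((norm_mul_le _ _).trans_lt (by linarith))
    have huz : IsUnit (algebraMap ℂ B z - q) := ⟨⟨_, S, ha, hb⟩, rfl⟩
    have hzx : z ∈ resolventSet ℂ x := by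
      rw [spectrum.mem_resolventSet_iff]
      have : algebraMap ℂ B z - x = (algebraMap ℂ B z - q) * (1 - S * (x - q)) := by
        rw [mul_sub, mul_one, ← mul_assoc, ha, one_mul]; abel
      rw [this]
      exact huz.mul hu
    refine ⟨hzx, ?_⟩
    have hid : resolvent x z - S = resolvent x z * ((x - q) * S) := by
      have e1 : resolvent x z * (algebraMap ℂ B z - x) = 1 :=
        Ring.inverse_mul_cancel _ (spectrum.mem_resolventSet_iff.mp hzx)
      have : (x - q) * S = 1 - (algebraMap ℂ B z - x) * S := by
        rw [← ha, ← sub_mul]; congr 1; abel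
      rw [this, mul_sub, mul_one, ← mul_assoc, e1, one_mul]
    have hle : ‖resolvent x z - S‖ ≤ ‖resolvent x z‖ * (‖x - q‖ * ‖S‖) := by
      rw [hid]
      exact (norm_mul_le _ _).trans (by gcongr; exact norm_mul_le _ _)
    have hRn : ‖resolvent x z‖ ≤ 2 * ‖S‖ := by
      have := norm_sub_norm_le (resolvent x z) S
      nlinarith [norm_nonneg (resolvent x z)]
    calc _ ≤ ‖resolvent x z‖ * (‖x - q‖ * ‖S‖) := hle
      _ ≤ (2 * (7 * m)) * (‖x - q‖ * (7 * m)) := by gcongr; linarith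
      _ = 98 * m ^ 2 * ‖x - q‖ := by ring
  refine ⟨fun z hz => ?_, ?_, ?_⟩
  · rw [mem_sphere_iff_norm] at hz
    exact (key z (by rw [hz]; norm_num) hz.le).1
  · exact isIdempotentElem_rieszIntegral (r := 1 / 5) (by norm_num) (by norm_num)
      fun z hz hz' => (key z hz hz').1
  · have hne1 : ∀ z ∈ sphere (1 : ℂ) (1 / 4), z - 1 ≠ 0 := fun z hz h => by
      rw [mem_sphere_iff_norm, h] at hz; norm_num at hz
    have hne0 : ∀ z ∈ closedBall (1 : ℂ) (1 / 4), z ≠ 0 := fun z hz h => by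
      rw [mem_closedBall_iff_norm, h] at hz; norm_num at hz
    have c1 : ContinuousOn (fun z : ℂ => (z - 1)⁻¹ • q) (sphere (1 : ℂ) (1 / 4)) :=
      ((continuousOn_id.sub continuousOn_const).inv₀ hne1).smul continuousOn_const
    have c2 : ContinuousOn (fun z : ℂ => z⁻¹ • (1 - q)) (closedBall (1 : ℂ) (1 / 4)) :=
      (continuousOn_id.inv₀ hne0).smul continuousOn_const
    have hqint : (2 * Real.pi * I : ℂ)⁻¹ •
        ∮ z in C(1, 1 / 4), ((z - 1)⁻¹ • q + z⁻¹ • (1 - q)) = q := by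
      rw [circleIntegral.integral_add (c1.circleIntegrable (by norm_num))
        ((c2.mono sphere_subset_closedBall).circleIntegrable (by norm_num)),
        circleIntegral.integral_smul_const,
        circleIntegral.integral_sub_inv_of_mem_ball (mem_ball_self (by norm_num)),
        circleIntegral_eq_zero_of_differentiable_on_off_countable (by norm_num)
          Set.countable_empty c2, add_zero, smul_smul,
        inv_mul_cancel₀ Complex.two_pi_I_ne_zero, one_smul]
      intro z hz
      exact (differentiableAt_id.inv (hne0 z (ball_subset_closedBall hz.1))).smul_const _
    have hcx : ContinuousOn (resolvent x) (sphere (1 : ℂ) (1 / 4)) :=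
      (continuousOn_resolvent x).mono fun z hz => by
        rw [mem_sphere_iff_norm] at hz
        exact (key z (by rw [hz]; norm_num) hz.le).1
    have hd : rieszIntegral x 1 (1 / 4) - q = (2 * Real.pi * I : ℂ)⁻¹ •
        ∮ z in C(1, 1 / 4), (resolvent x z - ((z - 1)⁻¹ • q + z⁻¹ • (1 - q))) := by
      rw [circleIntegral.integral_sub (g := fun z => (z - 1)⁻¹ • q + z⁻¹ • (1 - q))
        (hcx.circleIntegrable (by norm_num))
        ((c1.add (c2.mono sphere_subset_closedBall)).circleIntegrable (by norm_num)), smul_sub,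
        hqint]
      rfl
    rw [hd]
    refine (circleIntegral.norm_two_pi_i_inv_smul_integral_le_of_norm_le_const (by norm_num)
      fun z hz => ?_).trans (b := 1 / 4 * (98 * m ^ 2 * ‖x - q‖)) ?_
    · rw [mem_sphere_iff_norm] at hz
      exact (key z (by rw [hz]; norm_num) hz.le).2
    · nlinarith [mul_nonneg (sq_nonneg m) (norm_nonneg (x - q))]

/-- Close idempotents `p`, `q` are similar, through `u = p q + (1 - p) (1 - q)`. -/
theorem exists_units_intertwining {B : Type w} [NormedRing B] [CompleteSpace B] {p q : B}
    (hp : IsIdempotentElem p) (hq : IsIdempotentElem q)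
    (h : ‖2 * p - 1‖ * ‖q - p‖ < 1) : ∃ u : Bˣ, (u : B) * q = p * u := by
  have e : p * q + (1 - p) * (1 - q) = 1 - -((2 * p - 1) * (q - p)) := by
    have := hp.eq
    simp only [mul_sub, sub_mul, mul_one, one_mul, mul_assoc, this]
    noncomm_ring
  have hu : IsUnit (p * q + (1 - p) * (1 - q)) := by
    rw [e]
    refine isUnit_one_sub_of_norm_lt_one ?_
    rw [norm_neg]
    exact (norm_mul_le _ _).trans_lt h
  refine ⟨hu.unit, ?_⟩
  have h1 : p * q + (1 - p) * (1 - q) = 2 * (p * q) + 1 - p - q := by noncomm_ring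
  simp only [IsUnit.unit_spec, h1]
  have e1 : p * (p * q) = p * q := by rw [← mul_assoc, hp.eq]
  have e2 : p * q * q = p * q := by rw [mul_assoc, hq.eq]
  simp only [mul_sub, sub_mul, mul_add, add_mul, mul_one, one_mul, two_mul, e1, e2, hp.eq, hq.eq]
  abel

end Riesz

/-! ### Matrices over a C*-algebra, and classes in `K₀` -/

section MatrixNorm

variable {n : Type v} [Fintype n] {B : Type w} [CStarAlgebra B]

theorem CStarMatrix.norm_ofMatrix_le_sum [PartialOrder B] [StarOrderedRing B] (x : Matrix n n B) :
    ‖CStarMatrix.ofMatrix x‖ ≤ ∑ i, ∑ j, ‖x i j‖ := by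
  classical
  -- diagonal matrix units give homomorphisms of C*-algebras, which are contractive
  let φ : n → B →⋆ₙₐ[ℂ] CStarMatrix n n B := fun j =>
    { toFun := fun b => CStarMatrix.ofMatrix (Matrix.single j j b)
      map_smul' := fun c b => congrArg CStarMatrix.ofMatrix (Matrix.smul_single c j j b).symm
      map_zero' := by simp
      map_add' := fun a b => by rw [CStarMatrix.of_add_of, Matrix.single_add]
      map_mul' := fun a b => (Matrix.single_mul_single_same (α := B) a j j j b).symm
      map_star' := fun a => by
        change Matrix.single j j (star a) = (Matrix.single j j a).conjTranspose
        rw [Matrix.conjTranspose_single] }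
  have hs : ∀ (i j : n) (b : B), ‖CStarMatrix.ofMatrix (Matrix.single i j b)‖ ≤ ‖b‖ := by
    intro i j b
    have h1 : star (CStarMatrix.ofMatrix (Matrix.single i j b)) *
        CStarMatrix.ofMatrix (Matrix.single i j b) = φ j (star b * b) := by
      change (Matrix.single i j b).conjTranspose * Matrix.single i j b = Matrix.single j j _
      rw [Matrix.conjTranspose_single, Matrix.single_mul_single_same]
    have h2 : ‖φ j (star b * b)‖ ≤ ‖star b * b‖ := NonUnitalStarAlgHom.norm_apply_le _ _
    rw [← h1, CStarRing.norm_star_mul_self, CStarRing.norm_star_mul_self] at h2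
    exact abs_le_of_sq_le_sq' (by nlinarith) (norm_nonneg b) |>.2
  have hx : CStarMatrix.ofMatrix x =
      ∑ i, ∑ j, CStarMatrix.ofMatrix (Matrix.single i j (x i j)) :=
    Matrix.matrix_eq_sum_single x
  rw [hx]
  exact (norm_sum_le _ _).trans (Finset.sum_le_sum fun i _ =>
    (norm_sum_le _ _).trans (Finset.sum_le_sum fun j _ => hs i j _))

theorem matrixNorm_le_sum (x : Matrix n n B) : matrixNorm x ≤ ∑ i, ∑ j, ‖x i j‖ :=
  letI := CStarAlgebra.spectralOrder B
  letI : StarOrderedRing B := CStarAlgebra.spectralOrderedRing B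
  CStarMatrix.norm_ofMatrix_le_sum x

end MatrixNorm

section KZeroEq

variable {R : Type w} [Ring R]

theorem KZero.ofModule_eq_of_linearEquiv {M N : Type w} [AddCommGroup M] [Module Rᵐᵒᵖ M]
    [Module.Finite Rᵐᵒᵖ M] [Module.Projective Rᵐᵒᵖ M] [AddCommGroup N] [Module Rᵐᵒᵖ N]
    [Module.Finite Rᵐᵒᵖ N] [Module.Projective Rᵐᵒᵖ N] (e : M ≃ₗ[Rᵐᵒᵖ] N) :
    KZero.ofModule R M = KZero.ofModule R N := by
  unfold KZero.ofModule
  congr 1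
  exact Quotient.sound ⟨e⟩

/-- Similar idempotents have isomorphic modules. -/
def idempotentModuleEquiv {n : Type v} [Fintype n] [DecidableEq n] {p q : Matrix n n R}
    (u : (Matrix n n R)ˣ) (h : (u : Matrix n n R) * q = p * u) :
    idempotentModule q ≃ₗ[Rᵐᵒᵖ] idempotentModule p where
  toFun w := ⟨(u : Matrix n n R).mulVec w.1, by
    change p.mulVec _ = _
    have hw : q.mulVec w.1 = w.1 := w.2
    rw [Matrix.mulVec_mulVec, ← h, ← Matrix.mulVec_mulVec, hw]⟩
  map_add' a b := Subtype.ext (Matrix.mulVec_add _ a.1 b.1)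
  map_smul' c a := Subtype.ext (Matrix.mulVec_smul _ c a.1)
  invFun w := ⟨((u⁻¹ : (Matrix n n R)ˣ) : Matrix n n R).mulVec w.1, by
    change q.mulVec _ = _
    have hw : p.mulVec w.1 = w.1 := w.2
    have h' : q * ((u⁻¹ : (Matrix n n R)ˣ) : Matrix n n R) = (u⁻¹ : (Matrix n n R)ˣ) * p := by
      rw [Units.eq_inv_mul_iff_mul_eq, ← mul_assoc, h, mul_assoc, Units.mul_inv, mul_one]
    rw [Matrix.mulVec_mulVec, h', ← Matrix.mulVec_mulVec, hw]⟩
  left_inv w := Subtype.ext (by simp [Matrix.mulVec_mulVec])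
  right_inv w := Subtype.ext (by simp [Matrix.mulVec_mulVec])

end KZeroEq

section Chi

variable {n : Type v} [Fintype n] [DecidableEq n] {B : Type w} [CStarAlgebra B]

/-- If the matrix `x` is entrywise close to an idempotent `q`, then `χ(x)` is a well-defined
idempotent, similar to `q`. -/
theorem chiCalculus_of_near_idempotent {q x : Matrix n n B} (hq : IsIdempotentElem q) {m δ : ℝ}
    (hm : 1 ≤ m) (h1 : ∑ i, ∑ j, ‖q i j‖ ≤ m) (h2 : ∑ i, ∑ j, ‖x i j - q i j‖ ≤ δ)
    (hδ : 400 * m ^ 3 * δ ≤ 1) :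
    (∀ z ∈ Metric.sphere (1 : ℂ) (1 / 4), z ∈ resolventSet ℂ x) ∧
      IsIdempotentElem (chiCalculus x) ∧
      ∃ u : (Matrix n n B)ˣ, (u : Matrix n n B) * q = chiCalculus x * u := by
  let _ := CStarAlgebra.spectralOrder B
  have _ : StarOrderedRing B := CStarAlgebra.spectralOrderedRing B
  let Q : CStarMatrix n n B := CStarMatrix.ofMatrix q
  let Y : CStarMatrix n n B := CStarMatrix.ofMatrix x
  have hQ : IsIdempotentElem Q := hq
  have hQn : ‖Q‖ ≤ m := (CStarMatrix.norm_ofMatrix_le_sum q).trans h1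
  have hYQ : ‖Y - Q‖ ≤ δ := (CStarMatrix.norm_ofMatrix_le_sum (x - q)).trans h2
  have h1n : ‖(1 : CStarMatrix n n B)‖ ≤ 1 := by
    have h := CStarRing.norm_star_mul_self (x := (1 : CStarMatrix n n B))
    rw [star_one, mul_one] at h
    nlinarith [norm_nonneg (1 : CStarMatrix n n B)]
  have h1Q : ‖1 - Q‖ ≤ 2 * m := (norm_sub_le _ _).trans (by linarith)
  have hδ0 : 0 ≤ δ := (norm_nonneg _).trans hYQ
  have hm2 : m ≤ m ^ 3 := le_self_pow₀ hm (by norm_num)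
  have hmm : m ^ 2 ≤ m ^ 3 := pow_le_pow_right₀ hm (by norm_num)
  obtain ⟨ha, hb, hc⟩ := rieszIntegral_of_near_idempotent (x := Y) hQ (m := 2 * m) (by linarith)
    (by linarith) h1Q (by nlinarith [norm_nonneg (Y - Q)])
  set P := rieszIntegral Y 1 (1 / 4) with hP
  have hPQ : ‖P - Q‖ ≤ 100 * m ^ 2 * δ := by
    refine hc.trans ?_
    nlinarith [sq_nonneg m]
  have hPQ1 : ‖P - Q‖ ≤ 1 / 4 := hPQ.trans (by nlinarith)
  have h2P : ‖2 * P - 1‖ ≤ 3.5 * m := by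
    have e : 2 * P - 1 = P + P - 1 := by rw [two_mul]
    have hPn : ‖P‖ ≤ m + 1 / 4 := by
      have := norm_sub_norm_le P Q
      linarith
    have := norm_sub_le (P + P) 1
    have := norm_add_le P P
    rw [e]
    linarith
  obtain ⟨u, hu⟩ := exists_units_intertwining hb hQ (by
    rw [norm_sub_rev Q P]
    calc ‖2 * P - 1‖ * ‖P - Q‖ ≤ (3.5 * m) * (100 * m ^ 2 * δ) := by gcongr
      _ = 350 * m ^ 3 * δ := by ring
      _ < 1 := by nlinarith [pow_pos (by linarith : 0 < m) 3])
  exact ⟨ha, hb, u, hu⟩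

end Chi

/-! ### The module of sections of a cocycle -/

section Sections

variable {V X : Type v} [TopologicalSpace X] {A : Type u} [CStarAlgebra A] {U : V → Set X}

theorem GLCocycle.mul_val (v : GLCocycle U A) {i j k : V} {x : X} (hi : x ∈ U i) (hj : x ∈ U j)
    (hk : x ∈ U k) : (v.toFun i j x : A) * v.toFun j k x = v.toFun i k x := by
  rw [v.mul i j k x ⟨⟨hi, hj⟩, hk⟩, Units.val_mul]

theorem GLCocycle.continuousOn_val (v : GLCocycle U A) (i j : V) :
    ContinuousOn (fun x => (v.toFun i j x : A)) (U i ∩ U j) :=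
  Units.continuous_val.comp_continuousOn (v.continuousOn i j)

/-- A section is continuous if and only if it is so in the coordinates of every piece. -/
theorem isContSection_iff_continuousOn (hU : ∀ i, IsOpen (U i)) (hcov : ∀ x, ∃ i, x ∈ U i)
    (v : GLCocycle U A) (s : X → A) :
    IsContSection (cocycleBundle hU hcov v) s ↔
      ∀ i, ContinuousOn (fun x => (v.toFun i (hcov x).choose x : A) * s x) (U i) := by
  rw [isContSection_iff]
  constructor
  · intro h i x₀ hx₀
    refine ContinuousAt.continuousWithinAt ?_
    have h₀ := (hcov x₀).choose_spec
    set i₀ := (hcov x₀).choose with hi₀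
    have hn : U i ∩ U i₀ ∈ 𝓝 x₀ := ((hU i).inter (hU i₀)).mem_nhds ⟨hx₀, h₀⟩
    have hc := ((v.continuousOn_val i i₀).continuousAt hn).mul (h x₀)
    refine hc.congr ?_
    filter_upwards [hn] with x hx
    change (v.toFun i i₀ x : A) * ((v.toFun i₀ (hcov x).choose x : A) * s x) = _
    rw [← mul_assoc, v.mul_val hx.1 hx.2 (hcov x).choose_spec]
  · exact fun h x₀ => (h _).continuousAt ((hU _).mem_nhds (hcov x₀).choose_spec)

/-- Cohomologous cocycles have isomorphic modules of sections. -/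
noncomputable def bundleSectionsEquiv (hU : ∀ i, IsOpen (U i)) (hcov : ∀ x, ∃ i, x ∈ U i)
    (v v' : GLCocycle U A) (g : V → X → Aˣ) (hg : ∀ i, ContinuousOn (g i) (U i))
    (h : ∀ i j, ∀ x ∈ U i ∩ U j, g i x * v.toFun i j x = v'.toFun i j x * g j x) :
    bundleSections hU hcov v ≃ₗ[C(X, A)ᵐᵒᵖ] bundleSections hU hcov v' where
  toFun s := ⟨fun x => (g (hcov x).choose x : A) * s.1 x, by
    refine (isContSection_iff_continuousOn hU hcov v' _).mpr fun i => ?_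
    have hs := (isContSection_iff_continuousOn hU hcov v _).mp s.2 i
    refine ((Units.continuous_val.comp_continuousOn (hg i)).mul hs).congr fun x hx => ?_
    have e := congrArg Units.val (h i _ x ⟨hx, (hcov x).choose_spec⟩)
    simp only [Units.val_mul] at e
    change _ = (g i x : A) * ((v.toFun i (hcov x).choose x : A) * s.1 x)
    rw [← mul_assoc, ← mul_assoc, e]⟩
  map_add' s t := Subtype.ext (funext fun x => mul_add _ (s.1 x) (t.1 x))
  map_smul' f s := Subtype.ext (funext fun x => (mul_assoc _ (s.1 x) (f.unop x)).symm)
  invFun s := ⟨fun x => (((g (hcov x).choose x)⁻¹ : Aˣ) : A) * s.1 x, by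
    refine (isContSection_iff_continuousOn hU hcov v _).mpr fun i => ?_
    have hs := (isContSection_iff_continuousOn hU hcov v' _).mp s.2 i
    refine ((Units.continuous_val.comp_continuousOn (hg i).inv).mul hs).congr fun x hx => ?_
    have e : v.toFun i (hcov x).choose x * (g (hcov x).choose x)⁻¹ =
        (g i x)⁻¹ * v'.toFun i (hcov x).choose x := by
      rw [mul_inv_eq_iff_eq_mul, mul_assoc, ← h i _ x ⟨hx, (hcov x).choose_spec⟩,
        inv_mul_cancel_left]
    have e' := congrArg Units.val e
    simp only [Units.val_mul] at e'
    change _ = (((g i x)⁻¹ : Aˣ) : A) * ((v'.toFun i (hcov x).choose x : A) * s.1 x)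
    rw [← mul_assoc, ← mul_assoc, e']⟩
  left_inv s := Subtype.ext (funext fun x => Units.inv_mul_cancel_left _ (s.1 x))
  right_inv s := Subtype.ext (funext fun x => Units.mul_inv_cancel_left _ (s.1 x))

theorem ContinuousOn.smul_of_tsupport_subset {φ : X → ℂ} (hφ : Continuous φ) {W U' : Set X}
    (hW : IsOpen W) (hU' : IsOpen U') (hsupp : tsupport φ ⊆ U') {f : X → A}
    (hf : ContinuousOn f (W ∩ U')) : ContinuousOn (fun x => φ x • f x) W := by
  intro x hx
  refine ContinuousAt.continuousWithinAt ?_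
  by_cases hxs : x ∈ tsupport φ
  · exact hφ.continuousAt.smul (hf.continuousAt ((hW.inter hU').mem_nhds ⟨hx, hsupp hxs⟩))
  · have h0 : (fun x => φ x • f x) =ᶠ[𝓝 x] fun _ => 0 := by
      filter_upwards [notMem_tsupport_iff_eventuallyEq.mp hxs] with y hy
      rw [hy, Pi.zero_apply, zero_smul]
    exact continuousAt_const.congr h0.symm

/-- `φ i φ j v_ij`, extended by zero from `U i ∩ U j` to a continuous function on `X`. When the
`(φ i)²` form a partition of unity subordinate to the `U i`, this is an idempotent matrix whose
image is the module of sections. -/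
noncomputable def GLCocycle.idempotent (v : GLCocycle U A) (hU : ∀ i, IsOpen (U i))
    (φ : V → C(X, ℂ)) (hφ : ∀ i, tsupport (φ i) ⊆ U i) : Matrix V V C(X, A) := fun i j =>
  ⟨fun x => (φ i x * φ j x) • (v.toFun i j x : A), by
    rw [← continuousOn_univ]
    refine ContinuousOn.smul_of_tsupport_subset (by fun_prop) isOpen_univ
      ((hU i).inter (hU j)) (Set.subset_inter ?_ ?_) ((v.continuousOn_val i j).mono (by simp))
    · exact (tsupport_mul_subset_left (f := φ i) (g := φ j)).trans (hφ i)
    · exact (tsupport_mul_subset_right (f := φ i) (g := φ j)).trans (hφ j)⟩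

variable (v : GLCocycle U A) (hU : ∀ i, IsOpen (U i)) (φ : V → C(X, ℂ))
  (hφ : ∀ i, tsupport (φ i) ⊆ U i)

theorem GLCocycle.idempotent_apply (i j : V) (x : X) :
    v.idempotent hU φ hφ i j x = (φ i x * φ j x) • (v.toFun i j x : A) := rfl

theorem GLCocycle.smul_mul_val (v : GLCocycle U A) (φ : V → C(X, ℂ))
    (hφ : ∀ i, tsupport (φ i) ⊆ U i) {i j k : V} {x : X} (hk : x ∈ U k) :
    (φ i x * φ j x) • ((v.toFun i j x : A) * v.toFun j k x) =
      (φ i x * φ j x) • (v.toFun i k x : A) := by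
  by_cases hi : φ i x = 0
  · simp [hi]
  by_cases hj : φ j x = 0
  · simp [hj]
  rw [v.mul_val (hφ i (subset_tsupport _ hi)) (hφ j (subset_tsupport _ hj)) hk]

theorem GLCocycle.isIdempotentElem_idempotent [Fintype V]
    (hφ1 : ∀ x, ∑ i, φ i x * φ i x = 1) :
    IsIdempotentElem (v.idempotent hU φ hφ) := by
  change v.idempotent hU φ hφ * v.idempotent hU φ hφ = v.idempotent hU φ hφ
  ext i k x
  rw [Matrix.mul_apply, ContinuousMap.sum_apply]
  by_cases hk : φ k x = 0
  · simp [GLCocycle.idempotent_apply, hk]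
  have hk' := hφ k (subset_tsupport _ hk)
  have : ∀ j ∈ Finset.univ, (v.idempotent hU φ hφ i j * v.idempotent hU φ hφ j k) x =
      (φ j x * φ j x) • ((φ i x * φ k x) • (v.toFun i k x : A)) := by
    intro j _
    rw [ContinuousMap.mul_apply, idempotent_apply, idempotent_apply, smul_mul_smul_comm,
      show φ i x * φ j x * (φ j x * φ k x) = (φ j x * φ k x) * (φ i x * φ j x) by ring,
      mul_smul, v.smul_mul_val φ hφ hk', smul_smul, smul_smul]
    congr 1
    ring
  rw [Finset.sum_congr rfl this, ← Finset.sum_smul, hφ1, one_smul, idempotent_apply]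

/-- The module of sections is the image of the idempotent matrix `(φ i φ j v_ij)`: a section
corresponds to the vector of its coordinates in the pieces, the `i`-th one multiplied by `φ i`. -/
noncomputable def bundleSectionsEquivIdempotent [Fintype V] (hcov : ∀ x, ∃ i, x ∈ U i)
    (hφ1 : ∀ x, ∑ i, φ i x * φ i x = 1) :
    bundleSections hU hcov v ≃ₗ[C(X, A)ᵐᵒᵖ] idempotentModule (v.idempotent hU φ hφ) where
  toFun s := ⟨fun i => ⟨fun x => φ i x • ((v.toFun i (hcov x).choose x : A) * s.1 x), by
      rw [← continuousOn_univ]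
      exact ContinuousOn.smul_of_tsupport_subset (φ i).continuous isOpen_univ (hU i) (hφ i)
        (((isContSection_iff_continuousOn hU hcov v _).mp s.2 i).mono (by simp))⟩, by
    change (v.idempotent hU φ hφ).mulVec _ = _
    ext i x
    rw [Matrix.mulVec, dotProduct, ContinuousMap.sum_apply]
    have : ∀ j ∈ Finset.univ, (φ i x * φ j x) • (v.toFun i j x : A) *
        (φ j x • ((v.toFun j (hcov x).choose x : A) * s.1 x)) =
        (φ j x * φ j x) • (φ i x • ((v.toFun i (hcov x).choose x : A) * s.1 x)) := by
      intro j _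
      rw [smul_mul_smul_comm, ← mul_assoc, mul_comm _ (φ j x), mul_smul, ← smul_mul_assoc,
        v.smul_mul_val φ hφ (hcov x).choose_spec, smul_mul_assoc, smul_smul, smul_smul]
      congr 1
      ring
    refine (Finset.sum_congr rfl this).trans ?_
    rw [← Finset.sum_smul, hφ1, one_smul]
    rfl⟩
  map_add' s t := by
    refine Subtype.ext (funext fun i => ContinuousMap.ext fun x => ?_)
    change φ i x • (_ * (s.1 x + t.1 x)) = φ i x • (_ * s.1 x) + φ i x • (_ * t.1 x)
    rw [mul_add, smul_add]
  map_smul' f s := by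
    refine Subtype.ext (funext fun i => ContinuousMap.ext fun x => ?_)
    change φ i x • (_ * (s.1 x * f.unop x)) = φ i x • (_ * s.1 x) * f.unop x
    rw [← mul_assoc, smul_mul_assoc]
  invFun w := ⟨fun x => ∑ j, φ j x • ((v.toFun (hcov x).choose j x : A) * w.1 j x), by
    refine (isContSection_iff_continuousOn hU hcov v _).mpr fun i => ?_
    have hc : ContinuousOn (fun x => ∑ j, φ j x • ((v.toFun i j x : A) * w.1 j x)) (U i) :=
      continuousOn_finsetSum _ fun j _ => ContinuousOn.smul_of_tsupport_subset (φ j).continuous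
        (hU i) (hU j) (hφ j) ((v.continuousOn_val i j).mul (w.1 j).continuous.continuousOn)
    refine hc.congr fun x hx => ?_
    simp only [Finset.mul_sum]
    refine Finset.sum_congr rfl fun j _ => ?_
    by_cases hj : φ j x = 0
    · simp [hj]
    · rw [mul_smul_comm, ← mul_assoc,
        v.mul_val hx (hcov x).choose_spec (hφ j (subset_tsupport _ hj))]⟩
  left_inv s := by
    refine Subtype.ext (funext fun x => ?_)
    have : ∀ j ∈ Finset.univ, φ j x • ((v.toFun (hcov x).choose j x : A) *
        (φ j x • ((v.toFun j (hcov x).choose x : A) * s.1 x))) = (φ j x * φ j x) • s.1 x := by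
      intro j _
      by_cases hj : φ j x = 0
      · simp [hj]
      · rw [mul_smul_comm, ← mul_assoc, v.mul_val (hcov x).choose_spec
          (hφ j (subset_tsupport _ hj)) (hcov x).choose_spec,
          v.self_eq_one (hcov x).choose_spec, Units.val_one, one_mul, smul_smul]
    refine (Finset.sum_congr rfl this).trans ?_
    rw [← Finset.sum_smul, hφ1, one_smul]
  right_inv w := by
    refine Subtype.ext (funext fun i => ContinuousMap.ext fun x => ?_)
    have hw : (v.idempotent hU φ hφ).mulVec w.1 = w.1 := w.2
    have hx : (v.idempotent hU φ hφ).mulVec w.1 i x = w.1 i x := by rw [hw]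
    rw [← hx, Matrix.mulVec, dotProduct, ContinuousMap.sum_apply]
    change φ i x • ((v.toFun i (hcov x).choose x : A) *
      ∑ j, φ j x • ((v.toFun (hcov x).choose j x : A) * w.1 j x)) = _
    rw [Finset.mul_sum, Finset.smul_sum]
    refine Finset.sum_congr rfl fun j _ => ?_
    rw [ContinuousMap.mul_apply, v.idempotent_apply, mul_smul_comm, smul_smul, smul_mul_assoc]
    by_cases hi : φ i x = 0
    · simp [hi]
    by_cases hj : φ j x = 0
    · simp [hj]
    rw [← mul_assoc, v.mul_val (hφ i (subset_tsupport _ hi)) (hcov x).choose_spec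
      (hφ j (subset_tsupport _ hj))]

end Sections

/-! ### Elements close to a unitary -/

section NearUnitary

variable {A : Type u} [CStarAlgebra A]

theorem norm_le_one_of_star_mul_self {a : A} (h : star a * a = 1) : ‖a‖ ≤ 1 := by
  have h1 : ‖(1 : A)‖ ≤ 1 := by
    have h := CStarRing.norm_star_mul_self (x := (1 : A))
    rw [star_one, mul_one] at h
    nlinarith [norm_nonneg (1 : A)]
  have h2 := CStarRing.norm_star_mul_self (x := a)
  rw [h] at h2
  nlinarith [norm_nonneg a]

theorem norm_le_one_of_mem_unitary {w : A} (hw : w ∈ unitary A) : ‖w‖ ≤ 1 :=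
  norm_le_one_of_star_mul_self (Unitary.star_mul_self_of_mem hw)

/-- `ω(a)` is an isometry close to `a`, for `a` close to a unitary, because `a* a` is close
to `1`. -/
theorem polarUnitary_near {a w : A} (hw : w ∈ unitary A) {δ : ℝ} (h : ‖a - w‖ ≤ δ)
    (hδ : δ ≤ 1 / 6) :
    star (polarUnitary a) * polarUnitary a = 1 ∧ ‖polarUnitary a - w‖ ≤ 13 * δ := by
  have hw1 := norm_le_one_of_mem_unitary hw
  have hδ0 : 0 ≤ δ := (norm_nonneg _).trans h
  have ha1 : ‖a‖ ≤ 1 + δ := by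
    have := norm_sub_norm_le a w
    linarith
  set c := star a * a with hc
  have hcs : IsSelfAdjoint c := IsSelfAdjoint.star_mul_self a
  have hc1 : ‖c - 1‖ ≤ 3 * δ := by
    have e : c - 1 = star a * (a - w) + star (a - w) * w := by
      rw [hc, ← Unitary.star_mul_self_of_mem hw, star_sub]
      noncomm_ring
    rw [e]
    refine (norm_add_le _ _).trans ?_
    have e1 : ‖star a * (a - w)‖ ≤ (1 + δ) * δ := by
      refine (norm_mul_le _ _).trans ?_
      rw [norm_star]
      gcongr
    have e2 : ‖star (a - w) * w‖ ≤ δ * 1 := by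
      refine (norm_mul_le _ _).trans ?_
      rw [norm_star]
      gcongr
    nlinarith
  have hsp : ∀ t ∈ spectrum ℝ c, |t - 1| ≤ 3 * δ := by
    intro t ht
    have e : cfc (fun t : ℝ => t - 1) c = c - 1 := by
      rw [cfc_sub (fun t : ℝ => t) (fun _ => 1) c, cfc_id' ℝ c, cfc_const_one ℝ c]
    have := norm_apply_le_norm_cfc (fun t : ℝ => t - 1) c ht
    rw [e] at this
    exact this.trans hc1
  have hpos : ∀ t ∈ spectrum ℝ c, 1 / 2 ≤ t := fun t ht => by
    have := (abs_le.mp (hsp t ht)).1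
    linarith
  have hcont : ContinuousOn (fun t : ℝ => (√t)⁻¹) (spectrum ℝ c) :=
    Real.continuous_sqrt.continuousOn.inv₀ fun t ht =>
      (Real.sqrt_pos.mpr (by linarith [hpos t ht])).ne'
  set F := cfc (fun t : ℝ => (√t)⁻¹) c with hF
  have hFs : star F = F := (cfc_predicate (R := ℝ) (fun t : ℝ => (√t)⁻¹) c : IsSelfAdjoint F)
  have hp : polarUnitary a = a * F := rfl
  constructor
  · have e1 : c = cfc (fun t : ℝ => t) c := (cfc_id' ℝ c).symm
    have : star (polarUnitary a) * polarUnitary a = F * c * F := by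
      rw [hp, star_mul, hFs, hc]
      simp only [mul_assoc]
    rw [this]
    have e2 : F * c = cfc (fun t : ℝ => (√t)⁻¹ * t) c := by
      rw [cfc_mul (fun t : ℝ => (√t)⁻¹) (fun t : ℝ => t) c hcont continuousOn_id, cfc_id' ℝ c]
    rw [e2, hF, ← cfc_mul (fun t : ℝ => (√t)⁻¹ * t) (fun t : ℝ => (√t)⁻¹) c
      (hcont.mul continuousOn_id) hcont]
    rw [← cfc_const_one ℝ c]
    refine cfc_congr fun t ht => ?_
    have ht0 : 0 < t := by linarith [hpos t ht]
    have hs := Real.mul_self_sqrt ht0.le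
    have hs0 : √t ≠ 0 := (Real.sqrt_pos.mpr ht0).ne'
    field_simp
    rw [Real.sq_sqrt ht0.le]
  · have hF1 : ‖F - 1‖ ≤ 6 * δ := by
      have e : F - 1 = cfc (fun t : ℝ => (√t)⁻¹ - 1) c := by
        rw [cfc_sub (fun t : ℝ => (√t)⁻¹) (fun _ => 1) c hcont, cfc_const_one ℝ c]
      rw [e]
      refine norm_cfc_le (by linarith) fun t ht => ?_
      have ht0 : 0 < t := by linarith [hpos t ht]
      have hs := Real.mul_self_sqrt ht0.le
      have hs0 : 0 < √t := Real.sqrt_pos.mpr ht0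
      have hs2 : 1 / 2 ≤ √t := by
        rw [Real.le_sqrt (by norm_num) ht0.le]
        linarith [hpos t ht]
      have e2 : (√t)⁻¹ - 1 = (1 - t) / (√t * (1 + √t)) := by
        field_simp
        nlinarith
      rw [e2, Real.norm_eq_abs, abs_div, abs_of_pos (by positivity : 0 < √t * (1 + √t)),
        div_le_iff₀ (by positivity), abs_sub_comm]
      have h3 := hsp t ht
      have h4 : 1 / 2 ≤ √t * (1 + √t) := by nlinarith
      nlinarith
    have e : polarUnitary a - w = a * (F - 1) + (a - w) := by
      rw [hp]; noncomm_ring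
    rw [e]
    refine (norm_add_le _ _).trans ?_
    have e1 : ‖a * (F - 1)‖ ≤ (1 + δ) * (6 * δ) :=
      (norm_mul_le _ _).trans (by gcongr)
    nlinarith

theorem perturbQuasiRep_near {G : Type v} [Group G] (π : G → unitary A) {ε : ℝ} (hε : ε ≤ 1 / 3)
    (g : G) (h : ‖(π g : A) * π g⁻¹ - 1‖ ≤ ε) :
    ‖perturbQuasiRep (fun g => Unitary.toUnits (π g)) g‖ ≤ 1 ∧
      ‖perturbQuasiRep (fun g => Unitary.toUnits (π g)) g - π g‖ ≤ 7 * ε := by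
  have hε0 : 0 ≤ ε := (norm_nonneg _).trans h
  have h1 : ‖star (π g⁻¹ : A) - π g‖ ≤ ε := by
    have e : star (π g⁻¹ : A) - π g = -(((π g : A) * π g⁻¹ - 1) * star (π g⁻¹ : A)) := by
      rw [sub_mul, mul_assoc, Unitary.mul_star_self_of_mem (π g⁻¹).2]
      simp
    rw [e, norm_neg]
    refine (norm_mul_le _ _).trans ?_
    rw [norm_star]
    have := norm_le_one_of_mem_unitary (π g⁻¹).2
    nlinarith [norm_nonneg ((π g : A) * π g⁻¹ - 1)]
  have h2 : ‖(2 : ℂ)⁻¹ • ((π g : A) + star (π g⁻¹ : A)) - π g‖ ≤ ε / 2 := by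
    have e : (2 : ℂ)⁻¹ • ((π g : A) + star (π g⁻¹ : A)) - π g =
        (2 : ℂ)⁻¹ • (star (π g⁻¹ : A) - π g) := by
      have : (π g : A) = (2 : ℂ)⁻¹ • ((π g : A) + π g) := by
        rw [← two_smul ℂ, smul_smul]; norm_num
      nth_rewrite 2 [this]
      rw [← smul_sub]
      congr 1
      abel
    rw [e, norm_smul]
    norm_num
    linarith
  obtain ⟨h3, h4⟩ := polarUnitary_near (π g).2 h2 (by linarith)
  exact ⟨norm_le_one_of_star_mul_self h3, h4.trans (by linarith)⟩

theorem inverse_near {a w : A} (hw : w ∈ unitary A) {δ : ℝ} (h : ‖a - w‖ ≤ δ)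
    (hδ : δ ≤ 1 / 2) : IsUnit a ∧ ‖Ring.inverse a - star w‖ ≤ 2 * δ := by
  have hw1 := norm_le_one_of_mem_unitary hw
  have hws : ‖star w‖ ≤ 1 := by rwa [norm_star]
  have hu : IsUnit a := by
    have e : a = w * (1 - star w * (w - a)) := by
      rw [mul_sub, mul_one, ← mul_assoc, Unitary.mul_star_self_of_mem hw, one_mul]
      abel
    rw [e]
    refine IsUnit.mul (Unitary.toUnits ⟨w, hw⟩).isUnit (isUnit_one_sub_of_norm_lt_one ?_)
    refine (norm_mul_le _ _).trans_lt ?_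
    rw [norm_sub_rev] at h
    nlinarith [norm_nonneg (w - a)]
  refine ⟨hu, ?_⟩
  have e : Ring.inverse a - star w = Ring.inverse a * ((w - a) * star w) := by
    rw [sub_mul, Unitary.mul_star_self_of_mem hw, mul_sub, mul_one, ← mul_assoc,
      Ring.inverse_mul_cancel _ hu, one_mul]
  have h1 : ‖Ring.inverse a - star w‖ ≤ ‖Ring.inverse a‖ * δ := by
    nth_rewrite 1 [e]
    refine (norm_mul_le _ _).trans ?_
    gcongr
    refine (norm_mul_le _ _).trans ?_
    rw [norm_sub_rev] at h
    nlinarith [norm_nonneg (w - a)]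
  have h2 := norm_sub_norm_le (Ring.inverse a) (star w)
  have hδ0 : 0 ≤ δ := (norm_nonneg _).trans h
  nlinarith [norm_nonneg (Ring.inverse a)]

/-- A weighted mean of elements close to `y` is close to `y`. Terms of weight zero are not
constrained. -/
theorem norm_sum_smul_sub_le {ι : Type*} (s : Finset ι) (c : ι → ℝ) (x : ι → A) (y : A) {E : ℝ}
    (hc : ∀ i ∈ s, 0 ≤ c i) (hc1 : ∑ i ∈ s, c i = 1)
    (h : ∀ i ∈ s, c i ≠ 0 → ‖x i - y‖ ≤ E) :
    ‖∑ i ∈ s, (c i : ℂ) • x i - y‖ ≤ E := by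
  have e : ∑ i ∈ s, (c i : ℂ) • x i - y = ∑ i ∈ s, (c i : ℂ) • (x i - y) := by
    simp only [smul_sub, Finset.sum_sub_distrib]
    rw [← Finset.sum_smul, ← Complex.ofReal_sum, hc1, Complex.ofReal_one, one_smul]
  rw [e]
  refine (norm_sum_le _ _).trans ?_
  calc ∑ i ∈ s, ‖(c i : ℂ) • (x i - y)‖ ≤ ∑ i ∈ s, c i * E := by
        refine Finset.sum_le_sum fun i hi => ?_
        rw [norm_smul, Complex.norm_real, Real.norm_of_nonneg (hc i hi)]
        by_cases h0 : c i = 0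
        · simp [h0]
        · exact mul_le_mul_of_nonneg_left (h i hi h0) (hc i hi)
    _ = E := by rw [← Finset.sum_mul, hc1, one_mul]

end NearUnitary

/-! ### The block functions -/

section Block

variable {V : Type v} [PartialOrder V] {A : Type u} [CStarAlgebra A]

open scoped Classical in
theorem exists_list_of_chain (I : Finset V) (hI : ∀ i ∈ I, ∀ j ∈ I, i ≤ j ∨ j ≤ i) :
    ∃ l : List V, l.Pairwise (· < ·) ∧ l.toFinset = I := by
  induction hn : I.card generalizing I with
  | zero => exact ⟨[], List.Pairwise.nil, by rw [Finset.card_eq_zero.mp hn]; rfl⟩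
  | succ n ih =>
    obtain ⟨a, ha⟩ := I.exists_minimal (Finset.card_pos.mp (by omega))
    obtain ⟨l, hl, hlI⟩ := ih (I.erase a)
      (fun i hi j hj => hI i (Finset.mem_of_mem_erase hi) j (Finset.mem_of_mem_erase hj))
      (by rw [Finset.card_erase_of_mem ha.1, hn]; rfl)
    refine ⟨a :: l, List.pairwise_cons.mpr ⟨fun b hb => ?_, hl⟩, ?_⟩
    · have hb' : b ∈ I.erase a := by rw [← hlI]; exact List.mem_toFinset.mpr hb
      rw [Finset.mem_erase] at hb'
      refine lt_of_le_of_ne ?_ (Ne.symm hb'.1)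
      rcases hI a ha.1 b hb'.2 with h | h
      · exact h
      · exact ha.2 hb'.2 h
    · rw [List.toFinset_cons, hlI, Finset.insert_erase ha.1]

open scoped Classical in
theorem ascendingProd_toFinset (u : V → V → A) {l : List V} (hl : l.Pairwise (· < ·)) :
    ascendingProd u l.toFinset = (List.zipWith u l l.tail).prod := by
  have h : ∃ l' : List V, l'.Pairwise (· < ·) ∧ l'.toFinset = l.toFinset := ⟨l, hl, rfl⟩
  have heq : h.choose = l := by
    have hp : h.choose.Perm l := by
      refine List.perm_of_nodup_nodup_toFinset_eq ?_ ?_ h.choose_spec.2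
      · exact h.choose_spec.1.imp fun hab => hab.ne
      · exact hl.imp fun hab => hab.ne
    exact hp.eq_of_pairwise (fun a b _ _ hab hba => absurd hba hab.asymm) h.choose_spec.1 hl
  unfold ascendingProd
  rw [dif_pos h, heq]

theorem zipWith_tail_prod_append {V : Type v} (u : V → V → A) (l₁ l₂ : List V) (j : V) :
    (List.zipWith u (l₁ ++ j :: l₂) (l₁ ++ j :: l₂).tail).prod =
      (List.zipWith u (l₁ ++ [j]) (l₁ ++ [j]).tail).prod *
        (List.zipWith u (j :: l₂) (j :: l₂).tail).prod := by
  induction l₁ with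
  | nil => simp
  | cons a l ih =>
    cases l with
    | nil => simp
    | cons b l => simpa [mul_assoc] using congrArg (u a b * ·) ih

open scoped Classical in
theorem ascendingProd_union (u : V → V → A) {I₁ I₂ : Finset V} {j : V}
    (h₁ : ∀ i ∈ I₁, ∀ k ∈ I₁, i ≤ k ∨ k ≤ i) (h₂ : ∀ i ∈ I₂, ∀ k ∈ I₂, i ≤ k ∨ k ≤ i)
    (hj₁ : j ∈ I₁) (hj₂ : j ∈ I₂) (hle₁ : ∀ k ∈ I₁, k ≤ j) (hle₂ : ∀ k ∈ I₂, j ≤ k) :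
    ascendingProd u (I₁ ∪ I₂) = ascendingProd u I₁ * ascendingProd u I₂ := by
  obtain ⟨l₁, hl₁, rfl⟩ := exists_list_of_chain I₁ h₁
  obtain ⟨l₂, hl₂, rfl⟩ := exists_list_of_chain I₂ h₂
  simp only [List.mem_toFinset] at hj₁ hj₂ hle₁ hle₂
  obtain ⟨a, b, rfl⟩ := List.append_of_mem hj₁
  obtain ⟨c, d, rfl⟩ := List.append_of_mem hj₂
  have hb : b = [] := by
    cases b with
    | nil => rfl
    | cons y b =>
      have h := (List.pairwise_append.mp hl₁).2.1
      exact absurd (hle₁ y (by simp)) (not_le_of_gt (List.rel_of_pairwise_cons h (by simp)))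
  have hc : c = [] := by
    cases c with
    | nil => rfl
    | cons y c =>
      have h := (List.pairwise_append.mp hl₂).2.2 y (by simp) j (by simp)
      exact absurd (hle₂ y (by simp)) (not_le_of_gt h)
  subst hb hc
  have hl : (a ++ j :: d).Pairwise (· < ·) := by
    rw [List.pairwise_append] at hl₁ ⊢
    refine ⟨hl₁.1, hl₂, fun x hx y hy => ?_⟩
    have hxj := hl₁.2.2 x hx j (by simp)
    rcases List.mem_cons.mp hy with rfl | hy
    · exact hxj
    · exact hxj.trans (List.rel_of_pairwise_cons hl₂ hy)
  have hu : (a ++ [j]).toFinset ∪ ([] ++ j :: d).toFinset = (a ++ j :: d).toFinset := by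
    ext x; simp
  rw [hu, ascendingProd_toFinset u hl, ascendingProd_toFinset u hl₁, ascendingProd_toFinset u hl₂]
  exact zipWith_tail_prod_append u a d j

/-- The cocycle identity of `β(π)`: where `s j = 1`, only the sets `I` that contain `j` contribute,
and these are the unions of a set for `i, j` and a set for `j, k`. -/
theorem blockFun_mul (u : V → V → A) {σ : Finset V} (hσ : ∀ i ∈ σ, ∀ j ∈ σ, i ≤ j ∨ j ≤ i)
    {i j k : V} (hij : i ≤ j) (hjk : j ≤ k) (hj : j ∈ σ) {s : V → ℝ} (hs : s j = 1) :
    blockFun u σ i k s = blockFun u σ i j s * blockFun u σ j k s := by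
  classical
  unfold blockFun
  have hS : (σ.filter fun x => i ≤ x ∧ x ≤ j) ∪ (σ.filter fun x => j ≤ x ∧ x ≤ k) =
      σ.filter fun x => i ≤ x ∧ x ≤ k := by
    ext x
    simp only [Finset.mem_union, Finset.mem_filter]
    constructor
    · rintro (⟨h1, h2, h3⟩ | ⟨h1, h2, h3⟩)
      · exact ⟨h1, h2, h3.trans hjk⟩
      · exact ⟨h1, hij.trans h2, h3⟩
    · rintro ⟨h1, h2, h3⟩
      rcases hσ x h1 j hj with h | h
      · exact Or.inl ⟨h1, h2, h⟩
      · exact Or.inr ⟨h1, h, h3⟩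
  have hT : (σ.filter fun x => i ≤ x ∧ x ≤ j) ∩ (σ.filter fun x => j ≤ x ∧ x ≤ k) = {j} := by
    ext x
    simp only [Finset.mem_inter, Finset.mem_filter, Finset.mem_singleton]
    constructor
    · rintro ⟨⟨_, _, h⟩, ⟨_, h', _⟩⟩
      exact le_antisymm h h'
    · rintro rfl
      exact ⟨⟨hj, hij, le_rfl⟩, ⟨hj, le_rfl, hjk⟩⟩
  -- the subsets that avoid `j` have coefficient zero
  have h0 : ∀ I ∈ (σ.filter fun x => i ≤ x ∧ x ≤ k).powerset.filter fun I => i ∈ I ∧ k ∈ I,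
      ((∏ x ∈ σ.filter fun x => i ≤ x ∧ x ≤ k, if x ∈ I then s x else 1 - s x : ℝ) : ℂ) •
      ascendingProd u I ≠ 0 → j ∈ I := by
    intro I _ hne
    by_contra hjI
    refine hne ?_
    rw [Finset.prod_eq_zero (i := j), Complex.ofReal_zero, zero_smul]
    · exact Finset.mem_filter.mpr ⟨hj, hij, hjk⟩
    · rw [if_neg hjI, hs, sub_self]
  rw [← Finset.sum_filter_of_ne h0, Finset.sum_mul_sum, ← Finset.sum_product']
  refine Finset.sum_nbij' (fun I => (I.filter (· ≤ j), I.filter (j ≤ ·))) (fun p => p.1 ∪ p.2)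
    ?_ ?_ ?_ ?_ ?_
  · intro I hI
    simp only [Finset.mem_filter, Finset.mem_powerset, Finset.mem_product] at hI ⊢
    obtain ⟨⟨hIs, hiI, hkI⟩, hjI⟩ := hI
    refine ⟨⟨fun x hx => ?_, ⟨hiI, hij⟩, hjI, le_rfl⟩, fun x hx => ?_, ⟨hjI, le_rfl⟩, hkI, hjk⟩
    · have hx' := Finset.mem_filter.mp (hIs (Finset.mem_filter.mp hx).1)
      exact Finset.mem_filter.mpr ⟨hx'.1, hx'.2.1, (Finset.mem_filter.mp hx).2⟩
    · have hx' := Finset.mem_filter.mp (hIs (Finset.mem_filter.mp hx).1)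
      exact Finset.mem_filter.mpr ⟨hx'.1, (Finset.mem_filter.mp hx).2, hx'.2.2⟩
  · rintro ⟨I, J⟩ hp
    simp only [Finset.mem_filter, Finset.mem_powerset, Finset.mem_product] at hp ⊢
    obtain ⟨⟨hI, hi, hj1⟩, hJ, hj2, hk⟩ := hp
    refine ⟨⟨?_, Finset.mem_union_left _ hi, Finset.mem_union_right _ hk⟩,
      Finset.mem_union_left _ hj1⟩
    rw [← hS]
    exact Finset.union_subset_union hI hJ
  · intro I hI
    simp only [Finset.mem_filter, Finset.mem_powerset] at hI
    ext x
    simp only [Finset.mem_union, Finset.mem_filter, ← and_or_left, and_iff_left_iff_imp]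
    exact fun hx => hσ x (Finset.mem_filter.mp (hI.1.1 hx)).1 j hj
  · rintro ⟨I, J⟩ hp
    simp only [Finset.mem_filter, Finset.mem_powerset, Finset.mem_product] at hp
    obtain ⟨⟨hI, hi, hj1⟩, hJ, hj2, hk⟩ := hp
    have hI' : ∀ x ∈ I, x ≤ j := fun x hx => (Finset.mem_filter.mp (hI hx)).2.2
    have hJ' : ∀ x ∈ J, j ≤ x := fun x hx => (Finset.mem_filter.mp (hJ hx)).2.1
    refine Prod.ext ?_ ?_
    · ext x
      simp only [Finset.mem_union, Finset.mem_filter]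
      constructor
      · rintro ⟨h | h, hx⟩
        · exact h
        · rwa [le_antisymm hx (hJ' x h)]
      · exact fun h => ⟨Or.inl h, hI' x h⟩
    · ext x
      simp only [Finset.mem_union, Finset.mem_filter]
      constructor
      · rintro ⟨h | h, hx⟩
        · rwa [le_antisymm (hI' x h) hx]
        · exact h
      · exact fun h => ⟨Or.inr h, hJ' x h⟩
  · intro I hI
    simp only [Finset.mem_filter, Finset.mem_powerset] at hI
    obtain ⟨⟨hIs, hiI, hkI⟩, hjI⟩ := hI
    have hch : ∀ x ∈ I, ∀ y ∈ I, x ≤ y ∨ y ≤ x := fun x hx y hy =>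
      hσ x (Finset.mem_filter.mp (hIs hx)).1 y (Finset.mem_filter.mp (hIs hy)).1
    have hIu : I = I.filter (· ≤ j) ∪ I.filter (j ≤ ·) := by
      ext x
      simp only [Finset.mem_union, Finset.mem_filter, ← and_or_left]
      exact ⟨fun hx => ⟨hx, hch x hx j hjI⟩, fun h => h.1⟩
    have hprod : ascendingProd u I =
        ascendingProd u (I.filter (· ≤ j)) * ascendingProd u (I.filter (j ≤ ·)) := by
      nth_rewrite 1 [hIu]
      exact ascendingProd_union u
        (fun x hx y hy => hch x (Finset.mem_filter.mp hx).1 y (Finset.mem_filter.mp hy).1)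
        (fun x hx y hy => hch x (Finset.mem_filter.mp hx).1 y (Finset.mem_filter.mp hy).1)
        (Finset.mem_filter.mpr ⟨hjI, le_rfl⟩) (Finset.mem_filter.mpr ⟨hjI, le_rfl⟩)
        (fun x hx => (Finset.mem_filter.mp hx).2) (fun x hx => (Finset.mem_filter.mp hx).2)
    rw [smul_mul_smul_comm, ← hprod]
    congr 1
    rw [← Complex.ofReal_mul]
    congr 1
    have hun := Finset.prod_union_inter (s₁ := σ.filter fun x => i ≤ x ∧ x ≤ j)
      (s₂ := σ.filter fun x => j ≤ x ∧ x ≤ k) (f := fun x => if x ∈ I then s x else 1 - s x)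
    rw [hS, hT, Finset.prod_singleton, if_pos hjI, hs, mul_one] at hun
    rw [hun]
    congr 1
    · refine Finset.prod_congr rfl fun x hx => ?_
      simp [(Finset.mem_filter.mp hx).2.2]
    · refine Finset.prod_congr rfl fun x hx => ?_
      simp [(Finset.mem_filter.mp hx).2.1]

theorem continuous_blockFun (u : V → V → A) (σ : Finset V) (i j : V) :
    Continuous fun s : V → ℝ => blockFun u σ i j s := by
  classical
  unfold blockFun
  refine continuous_finsetSum _ fun I _ => Continuous.smul ?_ continuous_const
  refine Complex.continuous_ofReal.comp (continuous_finsetProd _ fun k _ => ?_)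
  split_ifs <;> fun_prop

/-- The coefficients of a block function add up to `1`. -/
theorem sum_blockFun_coeff {V : Type v} [DecidableEq V] {σ : Finset V} {i j : V} (hi : i ∈ σ)
    (hj : j ∈ σ) (s : V → ℝ) (hsi : s i = 1) (hsj : s j = 1) :
    ∑ I ∈ σ.powerset.filter fun I => i ∈ I ∧ j ∈ I,
      ∏ k ∈ σ, (if k ∈ I then s k else 1 - s k) = 1 := by
  have h0 : ∀ I ∈ σ.powerset, ∏ k ∈ σ, (if k ∈ I then s k else 1 - s k) ≠ 0 →
      i ∈ I ∧ j ∈ I := by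
    intro I _ hne
    constructor
    · by_contra h
      exact hne (Finset.prod_eq_zero hi (by rw [if_neg h, hsi, sub_self]))
    · by_contra h
      exact hne (Finset.prod_eq_zero hj (by rw [if_neg h, hsj, sub_self]))
  rw [Finset.sum_filter_of_ne h0]
  have h1 : ∏ k ∈ σ, (s k + (1 - s k)) = 1 := Finset.prod_eq_one fun k _ => by ring
  refine Eq.trans ?_ h1
  rw [Finset.prod_add]
  refine Finset.sum_congr rfl fun I hI => ?_
  rw [Finset.prod_ite]
  rw [Finset.mem_powerset] at hI
  congr 2
  · exact Finset.filter_mem_eq_inter.trans (Finset.inter_eq_right.mpr hI)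
  · exact (Finset.sdiff_eq_filter σ I).symm

end Block

/-! ### Block functions of an almost multiplicative family of unitaries -/

section AlmostCocycle

variable {V : Type v} {A : Type u} [CStarAlgebra A]

/-- Unitaries `P i j` that satisfy the cocycle identity up to `ε` on the simplices of `K`. -/
structure IsAlmostCocycle (K : AbstractSimplicialComplex V) (P : V → V → A) (ε : ℝ) : Prop where
  mem_unitary : ∀ i j, P i j ∈ unitary A
  self_eq_one : ∀ i, P i i = 1
  near_mul : ∀ σ ∈ K, ∀ i ∈ σ, ∀ j ∈ σ, ∀ k ∈ σ, ‖P i j * P j k - P i k‖ ≤ ε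

variable {K : AbstractSimplicialComplex V} {P : V → V → A} {ε : ℝ}

theorem mem_of_subset_of_mem {V : Type v} {K : AbstractSimplicialComplex V} {σ τ : Finset V}
    (hσ : σ ∈ K) (h : τ ⊆ σ) (hne : τ.Nonempty) : τ ∈ K :=
  (K.isRelLowerSet_faces hσ).2 h hne

theorem IsAlmostCocycle.norm_le (hP : IsAlmostCocycle K P ε) (i j : V) : ‖P i j‖ ≤ 1 :=
  norm_le_one_of_mem_unitary (hP.mem_unitary i j)

theorem IsAlmostCocycle.star_near (hP : IsAlmostCocycle K P ε) {σ : Finset V} (hσ : σ ∈ K)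
    {i j : V} (hi : i ∈ σ) (hj : j ∈ σ) : ‖star (P i j) - P j i‖ ≤ ε := by
  have h := hP.near_mul σ hσ i hi j hj i hi
  have e : star (P i j) - P j i = -(star (P i j) * (P i j * P j i - P i i)) := by
    rw [mul_sub, ← mul_assoc, Unitary.star_mul_self_of_mem (hP.mem_unitary i j), hP.self_eq_one]
    simp
  rw [e, norm_neg]
  refine (norm_mul_le _ _).trans ?_
  rw [norm_star]
  nlinarith [hP.norm_le i j, norm_nonneg (P i j), norm_nonneg (P i j * P j i - P i i)]

theorem IsAlmostCocycle.zipWith_near (hP : IsAlmostCocycle K P ε) {u : V → V → A}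
    (hu1 : ∀ i j, ‖u i j‖ ≤ 1) (hu : ∀ i j, ‖u i j - P i j‖ ≤ 7 * ε) {σ : Finset V} (hσ : σ ∈ K)
    (l : List V) (a z : V) (hl : ∀ x ∈ a :: l, x ∈ σ) (hz : (a :: l).getLast? = some z) :
    ‖(List.zipWith u (a :: l) (a :: l).tail).prod - P a z‖ ≤ l.length * (8 * ε) := by
  induction l generalizing a with
  | nil =>
    simp only [List.getLast?_singleton, Option.some.injEq] at hz
    subst hz
    simp [hP.self_eq_one]
  | cons b l ih =>
    rw [List.getLast?_cons_cons] at hz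
    have hz' : z ∈ σ := hl z (List.mem_cons_of_mem _ (List.mem_of_getLast? hz))
    have h1 := ih b (fun x hx => hl x (List.mem_cons_of_mem _ hx)) hz
    set Q := (List.zipWith u (b :: l) (b :: l).tail).prod with hQ
    have e : (List.zipWith u (a :: b :: l) (a :: b :: l).tail).prod = u a b * Q := by
      simp [hQ]
    have e2 : u a b * Q - P a z =
        u a b * (Q - P b z) + (u a b - P a b) * P b z + (P a b * P b z - P a z) := by
      noncomm_ring
    have h2 := hP.near_mul σ hσ a (hl a (by simp)) b (hl b (by simp)) z hz'
    have h3 : ‖u a b * (Q - P b z)‖ ≤ l.length * (8 * ε) := by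
      refine (norm_mul_le _ _).trans ?_
      nlinarith [hu1 a b, norm_nonneg (Q - P b z)]
    have h4 : ‖(u a b - P a b) * P b z‖ ≤ 7 * ε := by
      refine (norm_mul_le _ _).trans ?_
      nlinarith [hP.norm_le b z, hu a b, norm_nonneg (u a b - P a b)]
    rw [e, e2]
    refine (norm_add₃_le).trans ?_
    push_cast [List.length_cons]
    linarith

theorem IsAlmostCocycle.nonneg (hP : IsAlmostCocycle K P ε) {σ : Finset V} (hσ : σ ∈ K) :
    0 ≤ ε := by
  obtain ⟨i, hi⟩ := (K.isRelLowerSet_faces hσ).1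
  exact (norm_nonneg _).trans (hP.near_mul σ hσ i hi i hi i hi)

variable [PartialOrder V]

theorem IsAlmostCocycle.ascendingProd_near [Fintype V] (hP : IsAlmostCocycle K P ε)
    {u : V → V → A} (hu1 : ∀ i j, ‖u i j‖ ≤ 1) (hu : ∀ i j, ‖u i j - P i j‖ ≤ 7 * ε)
    {σ : Finset V} (hσ : σ ∈ K) (hch : ∀ i ∈ σ, ∀ j ∈ σ, i ≤ j ∨ j ≤ i) {I : Finset V}
    (hI : I ⊆ σ) {i j : V} (hi : i ∈ I) (hj : j ∈ I) (hmin : ∀ k ∈ I, i ≤ k)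
    (hmax : ∀ k ∈ I, k ≤ j) :
    ‖ascendingProd u I - P i j‖ ≤ Fintype.card V * (8 * ε) := by
  classical
  have hε := hP.nonneg hσ
  obtain ⟨l, hl, hlI⟩ := exists_list_of_chain I fun a ha b hb => hch a (hI ha) b (hI hb)
  have hmem : ∀ x, x ∈ l ↔ x ∈ I := fun x => by rw [← hlI]; exact List.mem_toFinset.symm
  have hprod : ascendingProd u I = (List.zipWith u l l.tail).prod := by
    rw [← ascendingProd_toFinset u hl, ← hlI]
  have hlast : l.getLast? = some j := by
    obtain ⟨a, b, hab⟩ := List.append_of_mem ((hmem j).mpr hj)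
    cases b with
    | nil => rw [hab]; simp
    | cons y b =>
      rw [hab] at hl
      have h := List.rel_of_pairwise_cons (List.pairwise_append.mp hl).2.1
        (List.mem_cons_self (a := y) (l := b))
      exact absurd (hmax y ((hmem y).mp (by rw [hab]; simp))) (not_le_of_gt h)
  cases l with
  | nil => simp at hlast
  | cons a l =>
    have hai : a = i := by
      rcases List.mem_cons.mp ((hmem i).mpr hi) with h | h
      · exact h.symm
      · exact absurd (hmin a ((hmem a).mp (by simp)))
          (not_le_of_gt (List.rel_of_pairwise_cons hl h))
    subst hai
    rw [hprod]
    refine (hP.zipWith_near hu1 hu hσ l a j (fun x hx => hI ((hmem x).mp hx)) hlast).trans ?_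
    have hnd : (a :: l).Nodup := hl.imp fun h => h.ne
    have hlen : (l.length : ℝ) ≤ Fintype.card V := by
      have := hnd.length_le_card
      simp only [List.length_cons] at this
      exact_mod_cast (Nat.le_succ _).trans this
    gcongr

/-- Block functions take values close to `P i j`, being weighted means of products along
ascending paths from `i` to `j`. -/
theorem IsAlmostCocycle.blockFun_near [Fintype V] (hP : IsAlmostCocycle K P ε)
    {u : V → V → A} (hu1 : ∀ i j, ‖u i j‖ ≤ 1) (hu : ∀ i j, ‖u i j - P i j‖ ≤ 7 * ε)
    {σ : Finset V} (hσ : σ ∈ K) (hch : ∀ i ∈ σ, ∀ j ∈ σ, i ≤ j ∨ j ≤ i) {i j : V} (hi : i ∈ σ)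
    (hj : j ∈ σ) (hij : i ≤ j) {s : V → ℝ} (hs0 : ∀ k, 0 ≤ s k) (hs1 : ∀ k, s k ≤ 1)
    (hsi : s i = 1) (hsj : s j = 1) :
    ‖blockFun u σ i j s - P i j‖ ≤ Fintype.card V * (8 * ε) := by
  classical
  unfold blockFun
  have hi' : i ∈ σ.filter fun k => i ≤ k ∧ k ≤ j := Finset.mem_filter.mpr ⟨hi, le_rfl, hij⟩
  have hj' : j ∈ σ.filter fun k => i ≤ k ∧ k ≤ j := Finset.mem_filter.mpr ⟨hj, hij, le_rfl⟩
  refine norm_sum_smul_sub_le _ _ (fun I => ascendingProd u I) (P i j)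
    (fun I _ => Finset.prod_nonneg fun k _ => ?_) (sum_blockFun_coeff hi' hj' s hsi hsj) ?_
  · split_ifs
    · exact hs0 k
    · linarith [hs1 k]
  · intro I hI _
    simp only [Finset.mem_filter, Finset.mem_powerset] at hI
    exact hP.ascendingProd_near hu1 hu hσ hch (hI.1.trans (Finset.filter_subset _ _)) hI.2.1 hI.2.2
      (fun k hk => (Finset.mem_filter.mp (hI.1 hk)).2.1)
      (fun k hk => (Finset.mem_filter.mp (hI.1 hk)).2.2)

theorem blockFun_congr {V : Type v} [PartialOrder V] (u : V → V → A) (σ : Finset V) (i j : V)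
    {s s' : V → ℝ} (h : ∀ k ∈ σ, i ≤ k → k ≤ j → s k = s' k) :
    blockFun u σ i j s = blockFun u σ i j s' := by
  classical
  unfold blockFun
  refine Finset.sum_congr rfl fun I _ => ?_
  congr 2
  refine Finset.prod_congr rfl fun k hk => ?_
  have hk' := Finset.mem_filter.mp hk
  rw [h k hk'.1 hk'.2.1 hk'.2.2]

end AlmostCocycle

/-! ### Weights on the dual cells -/

section Weights

/-- The version of `Finset.prod_one_sub_ordered` for a finite chain in a partial order. -/
theorem sum_mul_prod_one_sub {V : Type v} [PartialOrder V] [DecidableEq V] [DecidableLT V]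
    (a : V → ℝ) (σ : Finset V)
    (hσ : ∀ i ∈ σ, ∀ j ∈ σ, i ≤ j ∨ j ≤ i) :
    ∑ m ∈ σ, a m * ∏ k ∈ σ with k < m, (1 - a k) = 1 - ∏ k ∈ σ, (1 - a k) := by
  induction hn : σ.card generalizing σ with
  | zero => simp [Finset.card_eq_zero.mp hn]
  | succ n ih =>
    obtain ⟨b, hb⟩ := σ.exists_maximal (Finset.card_pos.mp (by omega))
    have hle : ∀ k ∈ σ, k ≤ b := fun k hk => by
      rcases hσ k hk b hb.1 with h | h
      · exact h
      · exact hb.2 hk h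
    have ih' := ih (σ.erase b)
      (fun i hi j hj => hσ i (Finset.mem_of_mem_erase hi) j (Finset.mem_of_mem_erase hj))
      (by rw [Finset.card_erase_of_mem hb.1, hn]; rfl)
    have h1 : (σ.filter fun k => k < b) = σ.erase b := by
      ext k
      simp only [Finset.mem_filter, Finset.mem_erase]
      exact ⟨fun h => ⟨h.2.ne, h.1⟩, fun h => ⟨h.2, lt_of_le_of_ne (hle k h.2) h.1⟩⟩
    have h2 : ∑ m ∈ σ.erase b, a m * ∏ k ∈ σ with k < m, (1 - a k) =
        ∑ m ∈ σ.erase b, a m * ∏ k ∈ σ.erase b with k < m, (1 - a k) := by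
      refine Finset.sum_congr rfl fun m hm => ?_
      congr 2
      ext k
      simp only [Finset.mem_filter, Finset.mem_erase]
      refine ⟨fun h => ⟨⟨?_, h.1⟩, h.2⟩, fun h => ⟨h.1.2, h.2⟩⟩
      rintro rfl
      exact absurd (hle m (Finset.mem_of_mem_erase hm)) (not_le_of_gt h.2)
    rw [← Finset.sum_erase_add _ _ hb.1, h2, ih', h1, ← Finset.prod_erase_mul _ _ hb.1]
    ring

variable {V : Type v} [Fintype V] {K : AbstractSimplicialComplex V}

/-- The largest barycentric coordinate of `x`. -/
noncomputable def maxCoord (x : Polyhedron K) : ℝ := ‖(fun k => x.1 k : V → ℝ)‖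

/-- The modified barycentric coordinates `s_k = t_k / max t`. -/
noncomputable def modCoord (x : Polyhedron K) (k : V) : ℝ := x.1 k / maxCoord x

theorem coord_le_maxCoord (x : Polyhedron K) (k : V) : x.1 k ≤ maxCoord x :=
  (le_abs_self _).trans (norm_le_pi_norm (fun k => x.1 k : V → ℝ) k)

theorem maxCoord_pos (x : Polyhedron K) : 0 < maxCoord x := by
  by_contra h
  have h1 : ∑ i, x.1 i ≤ 0 := Finset.sum_nonpos fun i _ =>
    (coord_le_maxCoord x i).trans (not_lt.mp h)
  rw [x.2.2.1] at h1
  linarith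

theorem maxCoord_eq {x : Polyhedron K} {l : V} (h : x ∈ dualCell K l) : maxCoord x = x.1 l := by
  refine le_antisymm ?_ (coord_le_maxCoord x l)
  refine (pi_norm_le_iff_of_nonneg (x.2.1 l)).mpr fun k => ?_
  rw [Real.norm_of_nonneg (x.2.1 k)]
  exact h k

theorem continuous_coord (k : V) : Continuous fun x : Polyhedron K => x.1 k := by
  fun_prop

theorem continuous_modCoord (k : V) : Continuous fun x : Polyhedron K => modCoord x k := by
  refine (continuous_coord k).div ?_ fun x => (maxCoord_pos x).ne'
  exact (continuous_pi fun k => continuous_coord k).norm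

theorem modCoord_nonneg (x : Polyhedron K) (k : V) : 0 ≤ modCoord x k :=
  div_nonneg (x.2.1 k) (maxCoord_pos x).le

theorem modCoord_le_one (x : Polyhedron K) (k : V) : modCoord x k ≤ 1 :=
  div_le_one_of_le₀ (coord_le_maxCoord x k) (maxCoord_pos x).le

theorem modCoord_eq_one_iff {x : Polyhedron K} {l : V} :
    modCoord x l = 1 ↔ x ∈ dualCell K l := by
  rw [modCoord, div_eq_one_iff_eq (maxCoord_pos x).ne']
  exact ⟨fun h k => h ▸ coord_le_maxCoord x k, fun h => (maxCoord_eq h).symm⟩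

theorem mem_carrier_iff {x : Polyhedron K} {k : V} : k ∈ carrier x ↔ modCoord x k ≠ 0 := by
  simp [carrier, modCoord, (maxCoord_pos x).ne']

theorem carrier_mem (x : Polyhedron K) : carrier x ∈ K := x.2.2.2

theorem mem_carrier_of_mem_dualCell {x : Polyhedron K} {l : V} (h : x ∈ dualCell K l) :
    l ∈ carrier x := by
  rw [mem_carrier_iff, modCoord_eq_one_iff.mpr h]
  exact one_ne_zero

theorem isClosed_dualCell (l : V) : IsClosed (dualCell K l) := by
  have : dualCell K l = {x | modCoord x l = 1} := Set.ext fun x => modCoord_eq_one_iff.symm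
  rw [this]
  exact isClosed_eq (continuous_modCoord l) continuous_const

theorem exists_mem_dualCell (x : Polyhedron K) : ∃ l, x ∈ dualCell K l := by
  have hne : (Finset.univ : Finset V).Nonempty :=
    ⟨_, Finset.mem_univ ((K.isRelLowerSet_faces (carrier_mem x)).1.choose)⟩
  obtain ⟨i, -, hi⟩ := Finset.exists_max_image Finset.univ (fun i => x.1 i) hne
  exact ⟨i, fun j => hi j (Finset.mem_univ j)⟩

theorem dualCell_subset_dualNhd {ν : ℝ} (hν : 0 < ν) (i : V) : dualCell K i ⊆ dualNhd K ν i :=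
  fun x hx => by
    change Metric.infDist x _ < ν
    rwa [Metric.infDist_zero_of_mem hx]

/-- Sets `V_i` that have a point in common belong to the vertices of a simplex. -/
theorem SmallRadius.mem_of_mem {ν : ℝ} (hν : SmallRadius K ν) {s : Finset V} (hs : s.Nonempty)
    {x : Polyhedron K} (hx : ∀ i ∈ s, x ∈ dualNhd K ν i) : s ∈ K := by
  obtain ⟨y, hy⟩ := (hν.2 s).mp ⟨x, Set.mem_iInter₂.mpr hx⟩
  rw [Set.mem_iInter₂] at hy
  exact mem_of_subset_of_mem (carrier_mem y)
    (fun i hi => mem_carrier_of_mem_dualCell (hy i hi)) hs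

/-- The bump function `max 0 (1 - C (1 - s_k))`, equal to `1` on `c_k`, and non-zero only near
`c_k` if `C` is large. -/
noncomputable def bump (C : ℝ) (k : V) (x : Polyhedron K) : ℝ := max 0 (1 - C * (1 - modCoord x k))

theorem continuous_bump (C : ℝ) (k : V) : Continuous (bump (K := K) C k) :=
  continuous_const.max (continuous_const.sub (continuous_const.mul
    (continuous_const.sub (continuous_modCoord k))))

theorem bump_nonneg (C : ℝ) (k : V) (x : Polyhedron K) : 0 ≤ bump C k x := le_max_left _ _

theorem bump_le_one {C : ℝ} (hC : 0 ≤ C) (k : V) (x : Polyhedron K) : bump C k x ≤ 1 :=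
  max_le zero_le_one (by nlinarith [modCoord_le_one x k])

theorem bump_eq_one (C : ℝ) {k : V} {x : Polyhedron K} (h : x ∈ dualCell K k) :
    bump C k x = 1 := by
  simp [bump, modCoord_eq_one_iff.mpr h]

theorem half_lt_modCoord_of_bump_ne_zero {C : ℝ} (hC : 2 ≤ C) {k : V} {x : Polyhedron K}
    (h : bump C k x ≠ 0) : 1 / 2 < modCoord x k := by
  by_contra hle
  exact h (max_eq_left (by nlinarith))

theorem exists_bump_support {ν : ℝ} (hν : 0 < ν) :
    ∃ C : ℝ, 2 ≤ C ∧ ∀ k, ∀ x : Polyhedron K, bump C k x ≠ 0 → x ∈ dualNhd K ν k := by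
  have h : ∀ k, ∃ C : ℝ, 0 ≤ C ∧ ∀ x : Polyhedron K, x ∉ dualNhd K ν k →
      1 ≤ C * (1 - modCoord x k) := by
    intro k
    have hc : IsCompact (dualNhd K ν k)ᶜ := (isOpen_dualNhd ν k).isClosed_compl.isCompact
    rcases (dualNhd K ν k)ᶜ.eq_empty_or_nonempty with he | hne
    · exact ⟨0, le_rfl, fun x hx => absurd (he ▸ hx : x ∈ (∅ : Set (Polyhedron K))) (by simp)⟩
    · obtain ⟨y, hy, hmax⟩ := hc.exists_isMaxOn hne (continuous_modCoord k).continuousOn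
      have hy1 : modCoord y k < 1 := by
        refine lt_of_le_of_ne (modCoord_le_one y k) fun h1 => hy ?_
        exact dualCell_subset_dualNhd hν k (modCoord_eq_one_iff.mp h1)
      refine ⟨(1 - modCoord y k)⁻¹, by rw [inv_nonneg]; linarith, fun x hx => ?_⟩
      have := hmax hx
      simp only [Set.mem_ofPred_eq] at this
      rw [← div_eq_inv_mul, one_le_div (by linarith)]
      linarith
  choose C hC0 hC using h
  have hsum : ∀ k, C k ≤ ∑ k, C k := fun k =>
    Finset.single_le_sum (fun k _ => hC0 k) (Finset.mem_univ k)
  refine ⟨2 + ∑ k, C k, by linarith [Finset.sum_nonneg fun k (_ : k ∈ Finset.univ) => hC0 k],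
    fun k x hne => ?_⟩
  by_contra hx
  refine hne (max_eq_left ?_)
  have h1 := hC k x hx
  have h2 := modCoord_le_one x k
  nlinarith [hsum k]

variable [PartialOrder V]

open scoped Classical in
/-- The weight of the vertex `m`. It vanishes on the cells `c_k` with `k < m`, so that where it
does not vanish only cells `c_l` with `m ≤ l` meet. -/
noncomputable def weight (C : ℝ) (m : V) (x : Polyhedron K) : ℝ :=
  bump C m x * ∏ k with k < m, (1 - bump C k x)

theorem continuous_weight (C : ℝ) (m : V) : Continuous (weight (K := K) C m) :=
  (continuous_bump C m).mul (continuous_finsetProd _ fun k _ =>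
    continuous_const.sub (continuous_bump C k))

theorem weight_nonneg {C : ℝ} (hC : 0 ≤ C) (m : V) (x : Polyhedron K) : 0 ≤ weight C m x :=
  mul_nonneg (bump_nonneg C m x) (Finset.prod_nonneg fun k _ => by
    linarith [bump_le_one hC k x])

theorem bump_ne_zero_of_weight_ne_zero {C : ℝ} {m : V} {x : Polyhedron K}
    (h : weight C m x ≠ 0) : bump C m x ≠ 0 := left_ne_zero_of_mul h

theorem mem_carrier_of_weight_ne_zero {C : ℝ} (hC : 2 ≤ C) {m : V} {x : Polyhedron K}
    (h : weight C m x ≠ 0) : m ∈ carrier x := by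
  rw [mem_carrier_iff]
  have := half_lt_modCoord_of_bump_ne_zero hC (bump_ne_zero_of_weight_ne_zero h)
  linarith

theorem le_of_weight_ne_zero (hK : ∀ σ ∈ K, ∀ i ∈ σ, ∀ j ∈ σ, i ≤ j ∨ j ≤ i) {C : ℝ}
    (hC : 2 ≤ C) {m l : V} {x : Polyhedron K} (h : weight C m x ≠ 0) (hl : x ∈ dualCell K l) :
    m ≤ l := by
  rcases hK _ (carrier_mem x) m (mem_carrier_of_weight_ne_zero hC h) l
    (mem_carrier_of_mem_dualCell hl) with hml | hlm
  · exact hml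
  · rcases hlm.eq_or_lt with rfl | hlt
    · exact le_rfl
    · refine absurd (Finset.prod_eq_zero (i := l) (by simpa using hlt) ?_)
        (right_ne_zero_of_mul h)
      rw [bump_eq_one C hl, sub_self]

theorem sum_weight (hK : ∀ σ ∈ K, ∀ i ∈ σ, ∀ j ∈ σ, i ≤ j ∨ j ≤ i) {C : ℝ} (hC : 2 ≤ C)
    (x : Polyhedron K) : ∑ m, weight C m x = 1 := by
  classical
  have h0 : ∀ k, k ∉ carrier x → bump C k x = 0 := fun k hk => by
    by_contra h
    rw [mem_carrier_iff, not_not] at hk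
    linarith [half_lt_modCoord_of_bump_ne_zero hC h]
  have h1 : ∑ m, weight C m x = ∑ m ∈ carrier x, bump C m x *
      ∏ k ∈ carrier x with k < m, (1 - bump C k x) := by
    rw [← Finset.sum_subset (Finset.subset_univ (carrier x)) fun m _ hm => by
      rw [weight, h0 m hm, zero_mul]]
    refine Finset.sum_congr rfl fun m _ => ?_
    rw [weight]
    congr 1
    refine (Finset.prod_subset (Finset.filter_subset_filter _ (Finset.subset_univ _))
      fun k hk hk' => ?_).symm
    rw [h0 k fun hkc => hk' (Finset.mem_filter.mpr ⟨hkc, (Finset.mem_filter.mp hk).2⟩), sub_zero]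
  rw [h1, sum_mul_prod_one_sub _ _ (hK _ (carrier_mem x))]
  obtain ⟨l, hl⟩ := exists_mem_dualCell x
  rw [Finset.prod_eq_zero (mem_carrier_of_mem_dualCell hl), sub_zero]
  rw [bump_eq_one C hl, sub_self]

end Weights

/-! ### Extension of the coordinate bundle -/

section Extension

variable {V : Type v} [Fintype V] [PartialOrder V] {A : Type u} [CStarAlgebra A]
  {K : AbstractSimplicialComplex V}

theorem modCoord_eq_div {V : Type v} [Fintype V] {K : AbstractSimplicialComplex V}
    {x : Polyhedron K} {i : V} (hi : x ∈ dualCell K i) (k : V) :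
    x.1 k / x.1 i = modCoord x k := by
  rw [modCoord, maxCoord_eq hi]

open scoped Classical in
/-- The block function of `i ≤ j` in the modified barycentric coordinates, with those of `i` and
`j` replaced by `1`. It extends the coordinate function `v_ij` of `β(π)` from `c_i ∩ c_j` to a
function that is continuous everywhere, and meaningful where the carrier contains `i` and `j`. -/
noncomputable def edgeFun (u : V → V → A) (i j : V) (x : Polyhedron K) : A :=
  blockFun u Finset.univ i j fun k => if k = i ∨ k = j then 1 else modCoord x k

theorem continuous_edgeFun (u : V → V → A) (i j : V) : Continuous (edgeFun (K := K) u i j) := by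
  refine (continuous_blockFun u Finset.univ i j).comp (continuous_pi fun k => ?_)
  split_ifs
  · exact continuous_const
  · exact continuous_modCoord k

open scoped Classical in
theorem edgeFun_eq_carrier (u : V → V → A) {i j : V} {x : Polyhedron K} (hi : i ∈ carrier x)
    (hj : j ∈ carrier x) : edgeFun u i j x =
      blockFun u (carrier x) i j fun k => if k = i ∨ k = j then 1 else modCoord x k := by
  refine blockFun_eq_of_subset u (Finset.subset_univ _) i j _ fun k _ hk => ?_
  have h1 : ¬ (k = i ∨ k = j) := by
    rintro (rfl | rfl) <;> contradiction
  rw [if_neg h1]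
  by_contra h
  exact hk (mem_carrier_iff.mpr h)

theorem edgeFun_eq_blockFun (u : V → V → A) {i j : V} {x : Polyhedron K}
    (hi : x ∈ dualCell K i) (hj : x ∈ dualCell K j) :
    edgeFun u i j x = blockFun u (carrier x) i j (modCoord x) := by
  rw [edgeFun_eq_carrier u (mem_carrier_of_mem_dualCell hi) (mem_carrier_of_mem_dualCell hj)]
  refine blockFun_congr u _ i j fun k _ _ _ => ?_
  split_ifs with h
  · rcases h with rfl | rfl
    · exact (modCoord_eq_one_iff.mpr hi).symm
    · exact (modCoord_eq_one_iff.mpr hj).symm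
  · rfl

theorem edgeFun_mul (hK : ∀ σ ∈ K, ∀ i ∈ σ, ∀ j ∈ σ, i ≤ j ∨ j ≤ i) (u : V → V → A) {i j k : V}
    {x : Polyhedron K} (hi : i ∈ carrier x) (hj : x ∈ dualCell K j) (hk : x ∈ dualCell K k)
    (hij : i ≤ j) (hjk : j ≤ k) :
    edgeFun u i k x = edgeFun u i j x * edgeFun u j k x := by
  classical
  have hj' := mem_carrier_of_mem_dualCell hj
  have hk' := mem_carrier_of_mem_dualCell hk
  have hsj := modCoord_eq_one_iff.mpr hj
  have hsk := modCoord_eq_one_iff.mpr hk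
  rw [edgeFun_eq_carrier u hi hk', edgeFun_eq_carrier u hi hj', edgeFun_eq_carrier u hj' hk']
  set s : V → ℝ := fun l => if l = i then 1 else modCoord x l with hs
  have e1 : ∀ l, (if l = i ∨ l = k then 1 else modCoord x l) = s l := fun l => by
    by_cases h1 : l = i <;> by_cases h2 : l = k <;> simp [hs, h1, h2, hsk]
  have e2 : ∀ l, (if l = i ∨ l = j then 1 else modCoord x l) = s l := fun l => by
    by_cases h1 : l = i <;> by_cases h2 : l = j <;> simp [hs, h1, h2, hsj]
  have e3 : ∀ l, j ≤ l → (if l = j ∨ l = k then 1 else modCoord x l) = s l := fun l hl => by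
    by_cases h1 : l = i
    · have : l = j := le_antisymm (h1 ▸ hij) hl
      simp [hs, this, hsj]
    · by_cases h2 : l = j
      · simp [hs, h2, hsj]
      · by_cases h3 : l = k <;> simp [hs, h1, h2, h3, hsk]
  rw [blockFun_congr u _ i k fun l _ _ _ => e1 l, blockFun_congr u _ i j fun l _ _ _ => e2 l,
    blockFun_congr u _ j k fun l _ hl _ => e3 l hl]
  refine blockFun_mul u (hK _ (carrier_mem x)) hij hjk hj' ?_
  simp [hs, hsj]

variable {P u : V → V → A} {ε C : ℝ}

theorem IsAlmostCocycle.edgeFun_near (hP : IsAlmostCocycle K P ε) (hu1 : ∀ i j, ‖u i j‖ ≤ 1)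
    (hu : ∀ i j, ‖u i j - P i j‖ ≤ 7 * ε) (hK : ∀ σ ∈ K, ∀ i ∈ σ, ∀ j ∈ σ, i ≤ j ∨ j ≤ i)
    {i j : V} {x : Polyhedron K} (hi : i ∈ carrier x) (hj : j ∈ carrier x) (hij : i ≤ j) :
    ‖edgeFun u i j x - P i j‖ ≤ Fintype.card V * (8 * ε) := by
  classical
  rw [edgeFun_eq_carrier u hi hj]
  refine hP.blockFun_near hu1 hu (carrier_mem x) (hK _ (carrier_mem x)) hi hj hij
    (fun k => ?_) (fun k => ?_) (by simp) (by simp)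
  · split_ifs
    exacts [zero_le_one, modCoord_nonneg x k]
  · split_ifs
    exacts [le_rfl, modCoord_le_one x k]

open scoped Classical in
/-- A deformation of `edgeFun u m i` that is close to `P m i` on all of `X`. It equals
`edgeFun u m i` on `c_i` where `s_m ≥ 1/2`, and `u m i` where the carrier does not contain both `i`
and `m`, so that `edgeFun` is not controlled. For `m ≰ i` it is not subject to any condition on
`c_i`, since the weight of `m` vanishes there. -/
noncomputable def cutoffEdgeFun (u : V → V → A) (C : ℝ) (m i : V) (x : Polyhedron K) : A :=
  if m ≤ i then
    u m i + ((bump C i x * min 1 (2 * modCoord x m) : ℝ) : ℂ) • (edgeFun u m i x - u m i)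
  else u m i

theorem continuous_cutoffEdgeFun (u : V → V → A) (C : ℝ) (m i : V) :
    Continuous (cutoffEdgeFun (K := K) u C m i) := by
  unfold cutoffEdgeFun
  split_ifs
  · refine continuous_const.add (Continuous.smul ?_ ((continuous_edgeFun u m i).sub
      continuous_const))
    exact Complex.continuous_ofReal.comp ((continuous_bump C i).mul
      (continuous_const.min (continuous_const.mul (continuous_modCoord m))))
  · exact continuous_const

theorem cutoffEdgeFun_eq (u : V → V → A) (hC : 2 ≤ C) {m i : V} {x : Polyhedron K} (hmi : m ≤ i)
    (hi : x ∈ dualCell K i) (hm : bump C m x ≠ 0) :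
    cutoffEdgeFun u C m i x = edgeFun u m i x := by
  have h1 : min 1 (2 * modCoord x m) = 1 :=
    min_eq_left (by linarith [half_lt_modCoord_of_bump_ne_zero hC hm])
  rw [cutoffEdgeFun, if_pos hmi, bump_eq_one C hi, h1, mul_one, Complex.ofReal_one, one_smul,
    add_sub_cancel]

theorem IsAlmostCocycle.cutoffEdgeFun_near (hP : IsAlmostCocycle K P ε)
    (hu1 : ∀ i j, ‖u i j‖ ≤ 1) (hu : ∀ i j, ‖u i j - P i j‖ ≤ 7 * ε)
    (hK : ∀ σ ∈ K, ∀ i ∈ σ, ∀ j ∈ σ, i ≤ j ∨ j ≤ i) (hC : 2 ≤ C) (m i : V) (x : Polyhedron K) :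
    ‖cutoffEdgeFun u C m i x - P m i‖ ≤ Fintype.card V * (8 * ε) := by
  have hε : 0 ≤ ε := hP.nonneg (carrier_mem x)
  have hN : (1 : ℝ) ≤ Fintype.card V := by
    exact_mod_cast Fintype.card_pos_iff.mpr ⟨m⟩
  have h7 : ‖u m i - P m i‖ ≤ Fintype.card V * (8 * ε) := (hu m i).trans (by nlinarith)
  unfold cutoffEdgeFun
  split_ifs with hmi
  · set θ := bump C i x * min 1 (2 * modCoord x m) with hθ
    have hmin0 : 0 ≤ min 1 (2 * modCoord x m) :=
      le_min zero_le_one (by linarith [modCoord_nonneg x m])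
    have hθ0 : 0 ≤ θ := mul_nonneg (bump_nonneg C i x) hmin0
    have hθ1 : θ ≤ 1 :=
      mul_le_one₀ (bump_le_one (by linarith) i x) hmin0 (min_le_left _ _)
    by_cases h0 : θ = 0
    · simpa [h0] using h7
    have him : i ∈ carrier x := by
      rw [mem_carrier_iff]
      linarith [half_lt_modCoord_of_bump_ne_zero hC (left_ne_zero_of_mul h0)]
    have hm : m ∈ carrier x := by
      rw [mem_carrier_iff]
      intro h
      simp [hθ, h] at h0
    have hF := hP.edgeFun_near hu1 hu hK hm him hmi
    have e : u m i + (θ : ℂ) • (edgeFun u m i x - u m i) - P m i =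
        ((1 - θ : ℝ) : ℂ) • (u m i - P m i) + (θ : ℂ) • (edgeFun u m i x - P m i) := by
      rw [Complex.ofReal_sub, Complex.ofReal_one]
      module
    rw [e]
    refine (norm_add_le _ _).trans ?_
    rw [norm_smul, norm_smul, Complex.norm_real, Complex.norm_real, Real.norm_of_nonneg hθ0,
      Real.norm_of_nonneg (by linarith : 0 ≤ 1 - θ)]
    nlinarith
  · exact h7

/-- The frame over `V_i`, in the coordinates of the cell `c_l`: the weighted mean over the
vertices `m` of the local frames `v_mi⁻¹ v_ml`. -/
noncomputable def frame (u : V → V → A) (C : ℝ) (i l : V) (x : Polyhedron K) : A :=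
  ∑ m, (weight C m x : ℂ) • (Ring.inverse (cutoffEdgeFun u C m i x) * cutoffEdgeFun u C m l x)

/-- The frames in the coordinates of two cells differ by the coordinate function of `β(π)`. -/
theorem frame_mul (hK : ∀ σ ∈ K, ∀ i ∈ σ, ∀ j ∈ σ, i ≤ j ∨ j ≤ i) (hC : 2 ≤ C) (u : V → V → A)
    (i : V) {l k : V} (hlk : l ≤ k) {x : Polyhedron K} (hl : x ∈ dualCell K l)
    (hk : x ∈ dualCell K k) :
    frame u C i k x = frame u C i l x * edgeFun u l k x := by
  unfold frame
  rw [Finset.sum_mul]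
  refine Finset.sum_congr rfl fun m _ => ?_
  by_cases h : weight C m x = 0
  · simp [h]
  have hml := le_of_weight_ne_zero hK hC h hl
  have hb := bump_ne_zero_of_weight_ne_zero h
  rw [cutoffEdgeFun_eq u hC (hml.trans hlk) hk hb, cutoffEdgeFun_eq u hC hml hl hb,
    edgeFun_mul hK u (mem_carrier_of_weight_ne_zero hC h) hl hk hml hlk, smul_mul_assoc,
    mul_assoc]

/-- The hypotheses for the construction of a flat extension: `P` is an almost cocycle, the
transition elements `u` are close to `P`, simplices are totally ordered, the `k`-th bump function
of parameter `C` is supported in `V_k`, and `ε` is small. -/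
structure IsExtensionDatum (K : AbstractSimplicialComplex V) (ν : ℝ) (P u : V → V → A)
    (ε C : ℝ) : Prop where
  smallRadius : SmallRadius K ν
  almostCocycle : IsAlmostCocycle K P ε
  norm_le : ∀ i j, ‖u i j‖ ≤ 1
  near : ∀ i j, ‖u i j - P i j‖ ≤ 7 * ε
  total : ∀ σ ∈ K, ∀ i ∈ σ, ∀ j ∈ σ, i ≤ j ∨ j ≤ i
  two_le : 2 ≤ C
  support : ∀ k, ∀ x : Polyhedron K, bump C k x ≠ 0 → x ∈ dualNhd K ν k
  small : Fintype.card V * (8 * ε) ≤ 1 / 14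

namespace IsExtensionDatum

variable {ν : ℝ}

theorem isUnit_cutoffEdgeFun (h : IsExtensionDatum K ν P u ε C) (m i : V) (x : Polyhedron K) :
    IsUnit (cutoffEdgeFun u C m i x) ∧
    ‖Ring.inverse (cutoffEdgeFun u C m i x) - star (P m i)‖ ≤
      2 * (Fintype.card V * (8 * ε)) :=
  inverse_near (h.almostCocycle.mem_unitary m i)
    (h.almostCocycle.cutoffEdgeFun_near h.norm_le h.near h.total h.two_le m i x)
    (by linarith [h.small])

theorem continuous_frame (h : IsExtensionDatum K ν P u ε C) (i l : V) :
    Continuous (frame (K := K) u C i l) := by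
  refine continuous_finsetSum _ fun m _ => Continuous.smul
    (Complex.continuous_ofReal.comp (continuous_weight C m))
    (Continuous.mul ?_ (continuous_cutoffEdgeFun u C m l))
  refine continuous_iff_continuousAt.mpr fun x => ?_
  obtain ⟨a, ha⟩ := (h.isUnit_cutoffEdgeFun m i x).1
  exact ContinuousAt.comp (f := cutoffEdgeFun u C m i) (x := x)
    (by rw [← ha]; exact NormedRing.inverse_continuousAt a)
    (continuous_cutoffEdgeFun u C m i).continuousAt

theorem frame_self (h : IsExtensionDatum K ν P u ε C) (i : V) (x : Polyhedron K) :
    frame u C i i x = 1 := by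
  unfold frame
  simp only [fun m => Ring.inverse_mul_cancel _ (h.isUnit_cutoffEdgeFun m i x).1]
  rw [← Finset.sum_smul, ← Complex.ofReal_sum, sum_weight h.total h.two_le, Complex.ofReal_one,
    one_smul]

theorem frame_near (h : IsExtensionDatum K ν P u ε C) {i l : V} {x : Polyhedron K}
    (hi : x ∈ dualNhd K ν i) (hl : x ∈ dualCell K l) :
    ‖frame u C i l x - P i l‖ ≤ 7 * (Fintype.card V * (8 * ε)) := by
  classical
  have hP := h.almostCocycle
  have hε : 0 ≤ ε := hP.nonneg (carrier_mem x)
  have hN : (1 : ℝ) ≤ Fintype.card V := by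
    exact_mod_cast Fintype.card_pos_iff.mpr ⟨i⟩
  have hs := h.small
  refine norm_sum_smul_sub_le _ _ _ _
    (fun m _ => weight_nonneg (by linarith [h.two_le]) m x) (sum_weight h.total h.two_le x) ?_
  intro m _ hm
  have hσ : ({i, m, l} : Finset V) ∈ K := by
    refine h.smallRadius.mem_of_mem (by simp) (x := x) fun k hk => ?_
    simp only [Finset.mem_insert, Finset.mem_singleton] at hk
    rcases hk with rfl | rfl | rfl
    · exact hi
    · exact h.support _ x (bump_ne_zero_of_weight_ne_zero hm)
    · exact dualCell_subset_dualNhd h.smallRadius.1 _ hl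
  have h1 := (h.isUnit_cutoffEdgeFun m i x).2
  have h2 := hP.star_near hσ (i := m) (j := i) (by simp) (by simp)
  have h3 := hP.cutoffEdgeFun_near h.norm_le h.near h.total h.two_le m l x
  have h4 := hP.near_mul _ hσ i (by simp) m (by simp) l (by simp)
  set E := Fintype.card V * (8 * ε) with hE
  set b := Ring.inverse (cutoffEdgeFun u C m i x)
  set c := cutoffEdgeFun u C m l x
  have hεE : 8 * ε ≤ E := by nlinarith
  have hb : ‖b - P i m‖ ≤ 2 * E + ε := by
    have e : b - P i m = (b - star (P m i)) + (star (P m i) - P i m) := by abel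
    rw [e]
    exact (norm_add_le _ _).trans (add_le_add h1 h2)
  have hc : ‖c‖ ≤ 1 + E := by
    have := norm_sub_norm_le c (P m l)
    linarith [hP.norm_le m l]
  have e : b * c - P i l =
      (b - P i m) * c + P i m * (c - P m l) + (P i m * P m l - P i l) := by noncomm_ring
  rw [e]
  refine norm_add₃_le.trans ?_
  have e1 : ‖(b - P i m) * c‖ ≤ (2 * E + ε) * (1 + E) := (norm_mul_le _ _).trans (by gcongr)
  have e2 : ‖P i m * (c - P m l)‖ ≤ 1 * E :=
    (norm_mul_le _ _).trans (by gcongr; exact hP.norm_le i m)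
  nlinarith

theorem isUnit_frame (h : IsExtensionDatum K ν P u ε C) {i l : V} {x : Polyhedron K}
    (hi : x ∈ dualNhd K ν i) (hl : x ∈ dualCell K l) :
    IsUnit (frame u C i l x) ∧ ‖Ring.inverse (frame u C i l x) - star (P i l)‖ ≤
      2 * (7 * (Fintype.card V * (8 * ε))) :=
  inverse_near (h.almostCocycle.mem_unitary i l) (h.frame_near hi hl) (by linarith [h.small])

end IsExtensionDatum

open scoped Classical in
/-- The frame as a unit of `A` (with the irrelevant value `1` where it is not invertible). -/
noncomputable def frameUnit (u : V → V → A) (C : ℝ) (i l : V) (x : Polyhedron K) : Aˣ :=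
  if h : IsUnit (frame u C i l x) then h.unit else 1

/-- A function that is continuous along each dual cell is continuous. -/
theorem continuousOn_of_dualCell {V : Type v} [Fintype V] {K : AbstractSimplicialComplex V}
    {Y : Type*} [TopologicalSpace Y] {f : Polyhedron K → Y}
    {W : Set (Polyhedron K)} (h : ∀ l, ContinuousOn f (W ∩ dualCell K l)) : ContinuousOn f W := by
  intro x hx
  have hW : W = ⋃ l, W ∩ dualCell K l := by
    ext y
    simp only [Set.mem_iUnion, Set.mem_inter_iff, exists_and_left]
    exact ⟨fun hy => ⟨hy, exists_mem_dualCell y⟩, fun hy => hy.1⟩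
  rw [hW, ContinuousWithinAt, nhdsWithin_iUnion, Filter.tendsto_iSup]
  intro l
  by_cases hl : x ∈ dualCell K l
  · exact h l x ⟨hx, hl⟩
  · have : 𝓝[W ∩ dualCell K l] x = ⊥ := by
      rw [← notMem_closure_iff_nhdsWithin_eq_bot]
      exact fun hc => hl ((isClosed_dualCell l).closure_subset_iff.mpr Set.inter_subset_right hc)
    rw [this]
    exact Filter.tendsto_bot

theorem continuousOn_units_iff {X : Type*} [TopologicalSpace X] {f : X → Aˣ} {s : Set X} :
    ContinuousOn f s ↔ ContinuousOn (fun x => (f x : A)) s :=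
  Units.isOpenEmbedding_val.isInducing.continuousOn_iff

/-- A vertex whose dual cell contains `x`. -/
noncomputable def cellIndex {V : Type v} [Fintype V] {K : AbstractSimplicialComplex V}
    (x : Polyhedron K) : V := (exists_mem_dualCell x).choose

theorem mem_dualCell_cellIndex {V : Type v} [Fintype V] {K : AbstractSimplicialComplex V}
    (x : Polyhedron K) : x ∈ dualCell K (cellIndex x) :=
  (exists_mem_dualCell x).choose_spec

namespace IsExtensionDatum

variable {ν : ℝ}

theorem frameUnit_val (h : IsExtensionDatum K ν P u ε C) {i l : V} {x : Polyhedron K}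
    (hi : x ∈ dualNhd K ν i) (hl : x ∈ dualCell K l) :
    (frameUnit u C i l x : A) = frame u C i l x := by
  rw [frameUnit, dif_pos (h.isUnit_frame hi hl).1, IsUnit.unit_spec]

theorem isUnit_edgeFun (h : IsExtensionDatum K ν P u ε C) {l k : V} {x : Polyhedron K}
    (hl : x ∈ dualCell K l) (hk : x ∈ dualCell K k) (hlk : l ≤ k) :
    IsUnit (edgeFun u l k x) :=
  (inverse_near (h.almostCocycle.mem_unitary l k)
    (h.almostCocycle.edgeFun_near h.norm_le h.near h.total (mem_carrier_of_mem_dualCell hl)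
      (mem_carrier_of_mem_dualCell hk) hlk) (by linarith [h.small])).1

theorem frameUnit_mul_inv (h : IsExtensionDatum K ν P u ε C) {i j l k : V} {x : Polyhedron K}
    (hi : x ∈ dualNhd K ν i) (hj : x ∈ dualNhd K ν j) (hl : x ∈ dualCell K l)
    (hk : x ∈ dualCell K k) :
    frameUnit u C i l x * (frameUnit u C j l x)⁻¹ =
      frameUnit u C i k x * (frameUnit u C j k x)⁻¹ := by
  wlog hlk : l ≤ k generalizing l k
  · refine (this hk hl ?_).symm
    exact (h.total _ (carrier_mem x) l (mem_carrier_of_mem_dualCell hl) k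
      (mem_carrier_of_mem_dualCell hk)).resolve_left hlk
  obtain ⟨b, hb⟩ := h.isUnit_edgeFun hl hk hlk
  have e : ∀ i, x ∈ dualNhd K ν i → frameUnit u C i k x = frameUnit u C i l x * b := by
    intro i hi
    refine Units.ext ?_
    rw [Units.val_mul, h.frameUnit_val hi hk, h.frameUnit_val hi hl, hb,
      frame_mul h.total h.two_le u i hlk hl hk]
  rw [e i hi, e j hj]
  group

/-- The cocycle on the cover `V_i` that compares the frames over `V_i` and `V_j`. -/
noncomputable def cocycle (h : IsExtensionDatum K ν P u ε C) : GLCocycle (dualNhd K ν) A where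
  toFun i j x := frameUnit u C i (cellIndex x) x * (frameUnit u C j (cellIndex x) x)⁻¹
  continuousOn i j := by
    refine continuousOn_of_dualCell fun l => ?_
    have hc : ∀ i, ContinuousOn (frameUnit u C i l) (dualNhd K ν i ∩ dualCell K l) := by
      intro i
      rw [continuousOn_units_iff]
      exact (h.continuous_frame i l).continuousOn.congr fun x hx => h.frameUnit_val hx.1 hx.2
    refine ContinuousOn.congr (f := fun x => frameUnit u C i l x * (frameUnit u C j l x)⁻¹)
      (((hc i).mono fun x hx => ⟨hx.1.1, hx.2⟩).mul ((hc j).mono fun x hx => ⟨hx.1.2, hx.2⟩).inv)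
      fun x hx => ?_
    exact h.frameUnit_mul_inv hx.1.1 hx.1.2 (mem_dualCell_cellIndex x) hx.2
  inv i j x _ := by group
  mul i j k x _ := by group

theorem cocycle_eq (h : IsExtensionDatum K ν P u ε C) {i j l : V} {x : Polyhedron K}
    (hi : x ∈ dualNhd K ν i) (hj : x ∈ dualNhd K ν j) (hl : x ∈ dualCell K l) :
    h.cocycle.toFun i j x = frameUnit u C i l x * (frameUnit u C j l x)⁻¹ :=
  h.frameUnit_mul_inv hi hj (mem_dualCell_cellIndex x) hl

theorem cocycle_near (h : IsExtensionDatum K ν P u ε C) {i j : V} {x : Polyhedron K}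
    (hi : x ∈ dualNhd K ν i) (hj : x ∈ dualNhd K ν j) :
    ‖(h.cocycle.toFun i j x : A) - P i j‖ ≤ 31 * (Fintype.card V * (8 * ε)) := by
  classical
  have hP := h.almostCocycle
  have hε : 0 ≤ ε := hP.nonneg (carrier_mem x)
  have hN : (1 : ℝ) ≤ Fintype.card V := by
    exact_mod_cast Fintype.card_pos_iff.mpr ⟨i⟩
  have hs := h.small
  obtain ⟨l, hl⟩ := exists_mem_dualCell x
  have hσ : ({i, j, l} : Finset V) ∈ K := by
    refine h.smallRadius.mem_of_mem (by simp) (x := x) fun k hk => ?_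
    simp only [Finset.mem_insert, Finset.mem_singleton] at hk
    rcases hk with rfl | rfl | rfl
    · exact hi
    · exact hj
    · exact dualCell_subset_dualNhd h.smallRadius.1 _ hl
  have hval : (h.cocycle.toFun i j x : A) =
      frame u C i l x * Ring.inverse (frame u C j l x) := by
    rw [h.cocycle_eq hi hj hl, Units.val_mul, h.frameUnit_val hi hl, ← h.frameUnit_val hj hl,
      Ring.inverse_unit]
  have h1 := h.frame_near hi hl
  have h2 := (h.isUnit_frame hj hl).2
  have h3 := hP.star_near hσ (i := j) (j := l) (by simp) (by simp)
  have h4 := hP.near_mul _ hσ i (by simp) l (by simp) j (by simp)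
  rw [hval]
  set E := Fintype.card V * (8 * ε) with hE
  set a := frame u C i l x
  set b := Ring.inverse (frame u C j l x)
  have hεE : 8 * ε ≤ E := by nlinarith
  have hb : ‖b - P l j‖ ≤ 14 * E + ε := by
    have e : b - P l j = (b - star (P j l)) + (star (P j l) - P l j) := by abel
    rw [e]
    exact (norm_add_le _ _).trans (by linarith)
  have hb' : ‖b‖ ≤ 1 + (14 * E + ε) := by
    have := norm_sub_norm_le b (P l j)
    linarith [hP.norm_le l j]
  have e : a * b - P i j =
      (a - P i l) * b + P i l * (b - P l j) + (P i l * P l j - P i j) := by noncomm_ring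
  rw [e]
  refine norm_add₃_le.trans ?_
  have e1 : ‖(a - P i l) * b‖ ≤ (7 * E) * (1 + (14 * E + ε)) :=
    (norm_mul_le _ _).trans (by gcongr)
  have e2 : ‖P i l * (b - P l j)‖ ≤ 1 * (14 * E + ε) :=
    (norm_mul_le _ _).trans (by gcongr; exact hP.norm_le i l)
  nlinarith

theorem isFlat_cocycle (h : IsExtensionDatum K ν P u ε C) (hε : 0 < ε) :
    h.cocycle.IsFlat (500 * Fintype.card V * ε) := by
  have hN : ∀ _ : V, (1 : ℝ) ≤ Fintype.card V := fun i => by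
    exact_mod_cast Fintype.card_pos_iff.mpr ⟨i⟩
  constructor
  · intro i j x hx
    refine (Metric.infDist_le_dist_of_mem (h.almostCocycle.mem_unitary i j)).trans_lt ?_
    rw [dist_eq_norm]
    refine (h.cocycle_near hx.1 hx.2).trans_lt ?_
    nlinarith [hN i]
  · intro i j x hx y hy
    have e : (h.cocycle.toFun i j x : A) - h.cocycle.toFun i j y =
        (h.cocycle.toFun i j x - P i j) - (h.cocycle.toFun i j y - P i j) := by abel
    rw [e]
    refine (norm_sub_le _ _).trans_lt ?_
    have h1 := h.cocycle_near hx.1 hx.2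
    have h2 := h.cocycle_near hy.1 hy.2
    nlinarith [hN i]

theorem cocycle_eq_edgeFun (h : IsExtensionDatum K ν P u ε C) {i j : V} {x : Polyhedron K}
    (hi : x ∈ dualCell K i) (hj : x ∈ dualCell K j) (hij : i ≤ j) :
    (h.cocycle.toFun i j x : A) = edgeFun u i j x := by
  have hi' := dualCell_subset_dualNhd h.smallRadius.1 i hi
  have hj' := dualCell_subset_dualNhd h.smallRadius.1 j hj
  have h1 : frameUnit u C j j x = 1 := Units.ext (by
    rw [h.frameUnit_val hj' hj, h.frame_self, Units.val_one])
  rw [h.cocycle_eq hi' hj' hj, h1, inv_one, mul_one, h.frameUnit_val hi' hj,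
    frame_mul h.total h.two_le u i hij hi hj, h.frame_self, one_mul]

end IsExtensionDatum

end Extension

/-! ### Independence of the extension -/

section Independence

variable {V : Type v} [Fintype V] {A : Type u} [CStarAlgebra A]
  {K : AbstractSimplicialComplex V} {ν : ℝ}

/-- The sections of a cocycle on the `V_i` are determined by its restriction to the dual
cells: cocycles that agree on the `c_i ∩ c_j` are cohomologous, through the functions
`v'_il v_li` on `V_i ∩ c_l`, which do not depend on `l`. -/
theorem nonempty_bundleSectionsEquiv (hν : 0 < ν) (v v' : GLCocycle (dualNhd K ν) A)
    (h : ∀ i j, ∀ x ∈ dualCell K i ∩ dualCell K j, v.toFun i j x = v'.toFun i j x) :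
    Nonempty (bundleSections (isOpen_dualNhd ν) (exists_mem_dualNhd hν) v
      ≃ₗ[C(Polyhedron K, A)ᵐᵒᵖ]
        bundleSections (isOpen_dualNhd ν) (exists_mem_dualNhd hν) v') := by
  have hsub := fun i => dualCell_subset_dualNhd (K := K) hν i
  have hind : ∀ i l k, ∀ x ∈ dualNhd K ν i, x ∈ dualCell K l → x ∈ dualCell K k →
      v'.toFun i l x * v.toFun l i x = v'.toFun i k x * v.toFun k i x := by
    intro i l k x hi hl hk
    rw [v'.mul i k l x ⟨⟨hi, hsub k hk⟩, hsub l hl⟩, v.mul k l i x ⟨⟨hsub k hk, hsub l hl⟩, hi⟩,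
      h k l x ⟨hk, hl⟩, mul_assoc]
  refine ⟨bundleSectionsEquiv _ _ v v'
    (fun i x => v'.toFun i (cellIndex x) x * v.toFun (cellIndex x) i x) (fun i => ?_) ?_⟩
  · refine continuousOn_of_dualCell fun l => ?_
    refine ContinuousOn.congr (f := fun x => v'.toFun i l x * v.toFun l i x)
      (((v'.continuousOn i l).mono ?_).mul ((v.continuousOn l i).mono ?_)) fun x hx => ?_
    · exact fun x hx => ⟨hx.1, hsub l hx.2⟩
    · exact fun x hx => ⟨hsub l hx.2, hx.1⟩
    · exact hind i _ l x hx.1 (mem_dualCell_cellIndex x) hx.2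
  · intro i j x hx
    have hl := hsub _ (mem_dualCell_cellIndex x)
    rw [mul_assoc, ← v.mul _ i j x ⟨⟨hl, hx.1⟩, hx.2⟩, ← mul_assoc,
      ← v'.mul i j _ x ⟨⟨hx.1, hx.2⟩, hl⟩]

end Independence

/-! ### The quasi-representation on the edges, and the Mishchenko projection -/

section QuasiRepEdges

variable {V : Type v} [DecidableEq V] {K : AbstractSimplicialComplex V} {T : SimpleGraph V}

theorem edgeElt_mem_edgeGenerators {i j : V} (h : ({i, j} : Finset V) ∈ K) :
    edgeElt K T i j ∈ edgeGenerators K T := by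
  rw [edgeElt, dif_pos h]
  exact ⟨_, rfl⟩

theorem edgeElt_self (i : V) : edgeElt K T i i = 1 := by
  unfold edgeElt
  split_ifs with h
  · refine PresentedGroup.one_of_mem (Or.inl ⟨⟨(i, i), h⟩, Or.inr rfl, rfl⟩)
  · rfl

theorem edgeElt_mul {σ : Finset V} (hσ : σ ∈ K) {i j k : V} (hi : i ∈ σ) (hj : j ∈ σ)
    (hk : k ∈ σ) : edgeElt K T i j * edgeElt K T j k = edgeElt K T i k := by
  have hm : ∀ τ : Finset V, τ.Nonempty → τ ⊆ σ → τ ∈ K := fun τ hne h =>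
    mem_of_subset_of_mem hσ h hne
  have hij : ({i, j} : Finset V) ∈ K := hm _ (by simp) (by
    simp [Finset.insert_subset_iff, hi, hj])
  have hjk : ({j, k} : Finset V) ∈ K := hm _ (by simp) (by
    simp [Finset.insert_subset_iff, hj, hk])
  have hik : ({i, k} : Finset V) ∈ K := hm _ (by simp) (by
    simp [Finset.insert_subset_iff, hi, hk])
  have hijk : ({i, j, k} : Finset V) ∈ K := hm _ (by simp) (by
    simp [Finset.insert_subset_iff, hi, hj, hk])
  rw [edgeElt, edgeElt, edgeElt, dif_pos hij, dif_pos hjk, dif_pos hik]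
  have h := PresentedGroup.one_of_mem (rels := edgeRelators K T)
    (Or.inr ⟨i, j, k, hijk, hij, hjk, hik, rfl⟩)
  rw [map_mul, map_mul, map_inv] at h
  exact mul_inv_eq_one.mp h

variable {A : Type u} [CStarAlgebra A] {π : EdgePathGroup K T → unitary A} {ε : ℝ}

theorem IsQuasiRep.unitary_one
    (hπ : IsQuasiRep (edgeGenerators K T) ε (fun g => Unitary.toUnits (π g))) :
    (π 1 : A) = 1 :=
  congrArg Units.val hπ.map_one

theorem IsQuasiRep.isAlmostCocycle
    (hπ : IsQuasiRep (edgeGenerators K T) ε (fun g => Unitary.toUnits (π g))) :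
    IsAlmostCocycle K (fun i j => (π (edgeElt K T i j) : A)) ε where
  mem_unitary i j := (π _).2
  self_eq_one i := by rw [edgeElt_self, hπ.unitary_one]
  near_mul σ hσ i hi j hj k hk := by
    have h := hπ.near_mul _ (edgeElt_mem_edgeGenerators (T := T) (i := i) (j := j)
        (mem_of_subset_of_mem hσ (by simp [Finset.insert_subset_iff, hi, hj]) (by simp)))
      _ (edgeElt_mem_edgeGenerators (T := T) (i := j) (j := k)
        (mem_of_subset_of_mem hσ (by simp [Finset.insert_subset_iff, hj, hk]) (by simp)))
    rw [edgeElt_mul hσ hi hj hk, norm_sub_rev] at h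
    exact h.le

theorem IsQuasiRep.perturb_near
    (hπ : IsQuasiRep (edgeGenerators K T) ε (fun g => Unitary.toUnits (π g))) (hε : 0 ≤ ε)
    (hε3 : ε ≤ 1 / 3) (i j : V) :
    ‖perturbQuasiRep (fun g => Unitary.toUnits (π g)) (edgeElt K T i j)‖ ≤ 1 ∧
      ‖perturbQuasiRep (fun g => Unitary.toUnits (π g)) (edgeElt K T i j) -
        π (edgeElt K T i j)‖ ≤ 7 * ε := by
  refine perturbQuasiRep_near π hε3 _ ?_
  by_cases h : ({i, j} : Finset V) ∈ K
  · have hinv : (edgeElt K T i j)⁻¹ = edgeElt K T j i := by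
      rw [inv_eq_iff_mul_eq_one, edgeElt_mul h (by simp) (by simp) (by simp), edgeElt_self]
    have := hπ.isAlmostCocycle.near_mul _ h i (by simp) j (by simp) i (by simp)
    rw [hinv]
    simpa only [edgeElt_self, hπ.unitary_one] using this
  · have : edgeElt K T i j = 1 := by rw [edgeElt, dif_neg h]
    rw [this, inv_one, hπ.unitary_one]
    simpa using hε

end QuasiRepEdges

section MishchenkoEstimate

variable {V : Type v} [Fintype V] {K : AbstractSimplicialComplex V}

/-- The square roots of a partition of unity, as complex functions. -/
noncomputable def sqrtPartition (χ : PartitionOfUnity V (Polyhedron K)) (i : V) :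
    C(Polyhedron K, ℂ) := ⟨fun x => (√(χ i x) : ℂ), by fun_prop⟩

theorem sqrtPartition_mul_self (χ : PartitionOfUnity V (Polyhedron K)) (i : V)
    (x : Polyhedron K) : sqrtPartition χ i x * sqrtPartition χ i x = (χ i x : ℂ) := by
  change (√(χ i x) : ℂ) * (√(χ i x) : ℂ) = _
  rw [← Complex.ofReal_mul, Real.mul_self_sqrt (χ.nonneg i x)]

theorem sum_partition (χ : PartitionOfUnity V (Polyhedron K)) (x : Polyhedron K) :
    ∑ i, χ i x = 1 := by
  rw [← finsum_eq_sum_of_fintype]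
  exact χ.sum_eq_one (Set.mem_univ x)

theorem sum_sqrtPartition (χ : PartitionOfUnity V (Polyhedron K)) (x : Polyhedron K) :
    ∑ i, sqrtPartition χ i x * sqrtPartition χ i x = 1 := by
  simp only [sqrtPartition_mul_self]
  rw [← Complex.ofReal_sum, sum_partition, Complex.ofReal_one]

theorem norm_sqrtPartition_le (χ : PartitionOfUnity V (Polyhedron K)) (i : V)
    (x : Polyhedron K) : ‖sqrtPartition χ i x‖ ≤ 1 := by
  change ‖(√(χ i x) : ℂ)‖ ≤ 1
  rw [Complex.norm_real, Real.norm_of_nonneg (Real.sqrt_nonneg _), Real.sqrt_le_one]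
  exact χ.le_one i x

theorem ne_zero_of_sqrtPartition_ne_zero {χ : PartitionOfUnity V (Polyhedron K)} {i : V}
    {x : Polyhedron K} (h : sqrtPartition χ i x ≠ 0) : χ i x ≠ 0 := fun h0 => h (by
  change (√(χ i x) : ℂ) = 0
  rw [h0, Real.sqrt_zero, Complex.ofReal_zero])

theorem tsupport_sqrtPartition {χ : PartitionOfUnity V (Polyhedron K)}
    {U : V → Set (Polyhedron K)} (hχ : χ.IsSubordinate U) (i : V) :
    tsupport (sqrtPartition χ i) ⊆ U i :=
  (closure_mono fun _ hx => ne_zero_of_sqrtPartition_ne_zero hx).trans (hχ i)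

variable [DecidableEq V] {T : SimpleGraph V} {A : Type u} [CStarAlgebra A] {ε : ℝ}

theorem pushMishchenko_apply (χ : PartitionOfUnity V (Polyhedron K))
    (π : EdgePathGroup K T → A) (i j : V) (x : Polyhedron K) :
    pushMishchenko T χ π i j x =
      (sqrtPartition χ i x * sqrtPartition χ j x) • π (edgeElt K T i j) := by
  have h : pushMishchenko T χ π i j = idTensor π (mishchenkoProj T χ i j) := rfl
  rw [h, idTensor, mishchenkoProj, MonoidAlgebra.coeff_single, Finsupp.sum_single_index (by simp)]
  change ((√(χ i x) * √(χ j x) : ℝ) : ℂ) • π (edgeElt K T i j) = _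
  rw [Complex.ofReal_mul]
  rfl

theorem norm_pushMishchenko_sq_sub_le {ν : ℝ} (hν : SmallRadius K ν)
    {χ : PartitionOfUnity V (Polyhedron K)} (hχ : χ.IsSubordinate (dualNhd K ν))
    {π : EdgePathGroup K T → A} (hπ : IsAlmostCocycle K (fun i j => π (edgeElt K T i j)) ε)
    (hε : 0 ≤ ε) (i k : V) :
    ‖(pushMishchenko T χ π * pushMishchenko T χ π - pushMishchenko T χ π) i k‖ ≤ ε := by
  rw [ContinuousMap.norm_le _ hε]
  intro x
  set P : V → V → A := fun i j => π (edgeElt K T i j)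
  have e : (pushMishchenko T χ π * pushMishchenko T χ π - pushMishchenko T χ π) i k x =
      (sqrtPartition χ i x * sqrtPartition χ k x) •
        (∑ j, (χ j x : ℂ) • (P i j * P j k) - P i k) := by
    rw [Matrix.sub_apply, ContinuousMap.sub_apply, Matrix.mul_apply, ContinuousMap.sum_apply,
      smul_sub, Finset.smul_sum, pushMishchenko_apply]
    congr 1
    refine Finset.sum_congr rfl fun j _ => ?_
    rw [ContinuousMap.mul_apply, pushMishchenko_apply, pushMishchenko_apply, smul_mul_smul_comm,
      smul_smul, ← sqrtPartition_mul_self]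
    congr 1
    ring
  have hmem : ∀ {j}, χ j x ≠ 0 → x ∈ dualNhd K ν j := fun {j} h =>
    hχ j (subset_tsupport _ h)
  rw [e]
  by_cases hi : sqrtPartition χ i x = 0
  · simpa [hi] using hε
  by_cases hk : sqrtPartition χ k x = 0
  · simpa [hk] using hε
  have h1 : ‖∑ j, (χ j x : ℂ) • (P i j * P j k) - P i k‖ ≤ ε := by
    refine norm_sum_smul_sub_le _ _ _ _ (fun j _ => χ.nonneg j x) (sum_partition χ x)
      fun j _ hj => ?_
    have hσ : ({i, j, k} : Finset V) ∈ K := by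
      refine hν.mem_of_mem (by simp) (x := x) fun l hl => ?_
      simp only [Finset.mem_insert, Finset.mem_singleton] at hl
      rcases hl with rfl | rfl | rfl
      · exact hmem (ne_zero_of_sqrtPartition_ne_zero hi)
      · exact hmem hj
      · exact hmem (ne_zero_of_sqrtPartition_ne_zero hk)
    exact hπ.near_mul _ hσ i (by simp) j (by simp) k (by simp)
  rw [norm_smul, norm_mul]
  have h2 := norm_sqrtPartition_le χ i x
  have h3 := norm_sqrtPartition_le χ k x
  have h4 : ‖sqrtPartition χ i x‖ * ‖sqrtPartition χ k x‖ ≤ 1 :=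
    mul_le_one₀ h2 (norm_nonneg _) h3
  nlinarith [norm_nonneg (∑ j, (χ j x : ℂ) • (P i j * P j k) - P i k)]

end MishchenkoEstimate

/-! ### The coordinate bundle and its class -/

theorem betaBundle_eq {V : Type v} [Fintype V] [DecidableEq V] [PartialOrder V]
    {K : AbstractSimplicialComplex V} {T : SimpleGraph V} {A : Type u} [CStarAlgebra A]
    (π : EdgePathGroup K T → Aˣ) {i j : V} {x : Polyhedron K} (hi : x ∈ dualCell K i)
    (hj : x ∈ dualCell K j) (hij : i < j) :
    betaBundle π i j x = edgeFun (fun k l => perturbQuasiRep π (edgeElt K T k l)) i j x ∧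
    betaBundle π j i x =
      Ring.inverse (edgeFun (fun k l => perturbQuasiRep π (edgeElt K T k l)) i j x) := by
  rw [edgeFun_eq_blockFun _ hi hj]
  have : (fun k => x.1 k / x.1 i) = modCoord x := funext fun k => modCoord_eq_div hi k
  unfold betaBundle
  simp only [if_pos hij, if_neg hij.asymm, this, and_self]

theorem IsExtensionDatum.cocycle_extends {V : Type v} [Fintype V] [DecidableEq V]
    [PartialOrder V] {K : AbstractSimplicialComplex V} {T : SimpleGraph V} {A : Type u}
    [CStarAlgebra A] {π : EdgePathGroup K T → Aˣ} {ν ε C : ℝ} {P : V → V → A}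
    (h : IsExtensionDatum K ν P (fun k l => perturbQuasiRep π (edgeElt K T k l)) ε C) :
    h.cocycle.Extends (betaBundle π) := by
  intro i j x hx
  have hsub := fun i => dualCell_subset_dualNhd (K := K) h.smallRadius.1 i
  rcases h.total _ (carrier_mem x) i (mem_carrier_of_mem_dualCell hx.1) j
    (mem_carrier_of_mem_dualCell hx.2) with hij | hji
  · rcases hij.eq_or_lt with rfl | hij
    · rw [h.cocycle.self_eq_one (hsub _ hx.1), betaBundle]
      simp
    · rw [(betaBundle_eq π hx.1 hx.2 hij).1, h.cocycle_eq_edgeFun hx.1 hx.2 hij.le]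
  · rcases hji.eq_or_lt with rfl | hji
    · rw [h.cocycle.self_eq_one (hsub _ hx.1), betaBundle]
      simp
    · rw [(betaBundle_eq π hx.2 hx.1 hji).2, h.cocycle.inv i j x ⟨hsub _ hx.1, hsub _ hx.2⟩,
        ← h.cocycle_eq_edgeFun hx.2 hx.1 hji.le, Ring.inverse_unit]

theorem proposition8p3 {V : Type v} [Fintype V] [DecidableEq V]
    (K : AbstractSimplicialComplex V) (hK : (oneSkeleton K).Connected) :
    ∃ ε₀ r : ℝ, 0 < ε₀ ∧ 0 < r ∧
      ∀ (T : SimpleGraph V), T ≤ oneSkeleton K → T.IsTree →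
      ∀ [PartialOrder V], (∀ σ ∈ K, ∀ i ∈ σ, ∀ j ∈ σ, i ≤ j ∨ j ≤ i) →
      ∀ (ν : ℝ) (hν : SmallRadius K ν)
        (χ : PartitionOfUnity V (Polyhedron K)), χ.IsSubordinate (dualNhd K ν) →
      ∀ (A : Type u) [CStarAlgebra A] (ε : ℝ), 0 < ε → ε < ε₀ →
      ∀ π : EdgePathGroup K T → unitary A,
        IsQuasiRep (edgeGenerators K T) ε (fun g => Unitary.toUnits (π g)) →
        -- `β(π)` extends to an almost flat cocycle on the open cover `{V_i}`
        (∃ v : GLCocycle (dualNhd K ν) A, v.IsFlat (r * ε) ∧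
          v.Extends (betaBundle fun g => Unitary.toUnits (π g))) ∧
        -- the push-forward `ℓ_π` is defined
        matrixNorm (pushMishchenko T χ (fun g => (π g : A)) *
          pushMishchenko T χ (fun g => (π g : A)) -
          pushMishchenko T χ (fun g => (π g : A))) < 1 / 4 ∧
        (∀ z ∈ Metric.sphere (1 : ℂ) (1 / 4),
          z ∈ resolventSet ℂ (pushMishchenko T χ (fun g => (π g : A)))) ∧
        ∃ hχ : IsIdempotentElem (chiCalculus (pushMishchenko T χ (fun g => (π g : A)))),
          -- `[E_π] = ℓ_π`, for the bundle `E_π` of any such extension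
          ∀ v : GLCocycle (dualNhd K ν) A,
            v.Extends (betaBundle fun g => Unitary.toUnits (π g)) →
            ∃ (_ : Module.Finite C(Polyhedron K, A)ᵐᵒᵖ
                (bundleSections (isOpen_dualNhd ν) (exists_mem_dualNhd hν.1) v))
              (_ : Module.Projective C(Polyhedron K, A)ᵐᵒᵖ
                (bundleSections (isOpen_dualNhd ν) (exists_mem_dualNhd hν.1) v)),
              KZero.ofModule C(Polyhedron K, A)
                  (bundleSections (isOpen_dualNhd ν) (exists_mem_dualNhd hν.1) v) =
                KZero.ofIdempotent _ hχ := by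
  have hne : Nonempty V := hK.nonempty
  have hN : (1 : ℝ) ≤ Fintype.card V := by exact_mod_cast Fintype.card_pos
  set N : ℝ := (Fintype.card V : ℝ) with hNdef
  have hN9 : 1 ≤ N ^ 9 := one_le_pow₀ hN
  -- The entries of `x_π` and of the idempotent `q` of the flat cocycle differ by at most `248 N ε`,
  -- and those of `q` are bounded by `4`. With `m = 4 N²` and `δ = 248 N³ ε`, the condition
  -- `400 m³ δ ≤ 1` reads `6348800 N⁹ ε ≤ 1`.
  refine ⟨1 / (10 ^ 7 * N ^ 9), 500 * N, by positivity, by positivity, ?_⟩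
  intro T _ _ _ htot ν hν χ hχ A _ ε hε hεlt π hπ
  have hε9 : 10 ^ 7 * (N ^ 9 * ε) < 1 := by
    rw [lt_div_iff₀ (by positivity)] at hεlt
    linarith
  have hpow : ∀ k, k ≤ 9 → N ^ k * ε ≤ N ^ 9 * ε := fun k hk => by gcongr
  have hp0 := hpow 0 (by norm_num)
  have hp1 := hpow 1 (by norm_num)
  have hp2 := hpow 2 (by norm_num)
  rw [pow_zero, one_mul] at hp0
  rw [pow_one] at hp1
  obtain ⟨C, hC, hCs⟩ := exists_bump_support (K := K) hν.1
  have hu := hπ.perturb_near hε.le (by linarith)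
  have D : IsExtensionDatum K ν (fun i j => (π (edgeElt K T i j) : A))
      (fun k l => perturbQuasiRep (fun g => Unitary.toUnits (π g)) (edgeElt K T k l)) ε C :=
    { smallRadius := hν
      almostCocycle := hπ.isAlmostCocycle
      norm_le := fun i j => (hu i j).1
      near := fun i j => (hu i j).2
      total := htot
      two_le := hC
      support := hCs
      small := by rw [← hNdef]; linarith }
  have hext := D.cocycle_extends
  refine ⟨⟨D.cocycle, D.isFlat_cocycle hε, hext⟩, ?_, ?_⟩
  · refine (matrixNorm_le_sum _).trans_lt ?_
    refine (Finset.sum_le_sum fun i _ => Finset.sum_le_sum fun k _ =>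
      norm_pushMishchenko_sq_sub_le hν hχ hπ.isAlmostCocycle hε.le i k).trans_lt ?_
    simp only [Finset.sum_const, Finset.card_univ, nsmul_eq_mul]
    rw [← hNdef]
    linarith
  · set x := pushMishchenko T χ (fun g => (π g : A)) with hx
    have hφ := tsupport_sqrtPartition hχ
    have hφ1 := sum_sqrtPartition χ
    set p := D.cocycle.idempotent (isOpen_dualNhd ν) (sqrtPartition χ) hφ with hp
    have hpi : IsIdempotentElem p := D.cocycle.isIdempotentElem_idempotent _ _ hφ hφ1
    have hw : ∀ i j y, ‖sqrtPartition χ i y * sqrtPartition χ j y‖ ≤ 1 := fun i j y => by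
      rw [norm_mul]
      exact mul_le_one₀ (norm_sqrtPartition_le χ i y) (norm_nonneg _)
        (norm_sqrtPartition_le χ j y)
    have hnear : ∀ i j y, sqrtPartition χ i y * sqrtPartition χ j y ≠ 0 →
        ‖(D.cocycle.toFun i j y : A) - π (edgeElt K T i j)‖ ≤ 31 * (N * (8 * ε)) := by
      intro i j y h
      exact D.cocycle_near (hφ i (subset_tsupport _ (left_ne_zero_of_mul h)))
        (hφ j (subset_tsupport _ (right_ne_zero_of_mul h)))
    have hE0 : 0 ≤ 31 * (N * (8 * ε)) := by positivity
    have hxp : ∀ i j, ‖x i j - p i j‖ ≤ 31 * (N * (8 * ε)) := by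
      intro i j
      rw [ContinuousMap.norm_le _ hE0]
      intro y
      rw [ContinuousMap.sub_apply, hx, pushMishchenko_apply, hp, GLCocycle.idempotent_apply,
        ← smul_sub, norm_smul]
      by_cases h : sqrtPartition χ i y * sqrtPartition χ j y = 0
      · simpa [h] using hE0
      · have h1 := hnear i j y h
        rw [norm_sub_rev] at h1
        calc _ ≤ 1 * (31 * (N * (8 * ε))) := by
              gcongr
              exact hw i j y
          _ = _ := one_mul _
    have hpn : ∀ i j, ‖p i j‖ ≤ 4 := by
      intro i j
      rw [ContinuousMap.norm_le _ (by norm_num)]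
      intro y
      rw [hp, GLCocycle.idempotent_apply, norm_smul]
      by_cases h : sqrtPartition χ i y * sqrtPartition χ j y = 0
      · simp [h]
      · have h1 := hnear i j y h
        have h2 := norm_sub_norm_le (D.cocycle.toFun i j y : A) (π (edgeElt K T i j))
        have h3 := norm_le_one_of_mem_unitary (π (edgeElt K T i j)).2
        calc _ ≤ 1 * (4 : ℝ) := by
              gcongr
              · exact hw i j y
              · linarith
          _ = _ := one_mul _
    obtain ⟨hres, hidem, w, hw⟩ := chiCalculus_of_near_idempotent (x := x) hpi
      (m := 4 * N ^ 2) (δ := 248 * N ^ 3 * ε) (by nlinarith)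
      ((Finset.sum_le_sum fun i _ => Finset.sum_le_sum fun j _ => hpn i j).trans (by
        simp only [Finset.sum_const, Finset.card_univ, nsmul_eq_mul]
        rw [← hNdef]
        exact le_of_eq (by ring)))
      ((Finset.sum_le_sum fun i _ => Finset.sum_le_sum fun j _ => hxp i j).trans (by
        simp only [Finset.sum_const, Finset.card_univ, nsmul_eq_mul]
        rw [← hNdef]
        exact le_of_eq (by ring)))
      (by
        have : 400 * (4 * N ^ 2) ^ 3 * (248 * N ^ 3 * ε) = 6348800 * (N ^ 9 * ε) := by ring
        rw [this]
        have : 0 ≤ N ^ 9 * ε := by positivity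
        linarith)
    refine ⟨hres, hidem, fun v hv => ?_⟩
    obtain ⟨e₁⟩ := nonempty_bundleSectionsEquiv hν.1 v D.cocycle fun i j y hy =>
      Units.ext ((hv i j y hy).trans (hext i j y hy).symm)
    have e := (e₁.trans (bundleSectionsEquivIdempotent D.cocycle (isOpen_dualNhd ν)
      (sqrtPartition χ) hφ (exists_mem_dualNhd hν.1) hφ1)).trans (idempotentModuleEquiv w hw)
    have := idempotentModule_finite _ hidem
    have := idempotentModule_projective _ hidem
    have hfin := Module.Finite.equiv e.symm
    have hproj := Module.Projective.of_equiv e.symm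
    exact ⟨hfin, hproj, KZero.ofModule_eq_of_linearEquiv e⟩
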